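/- Write $M_d=\mathbb{C}^{d\times d}$. A (quantum) channel on $M_d$ is a linear map $\mathcal{E}:M_d\to M_d$ that is trace preserving and completely positive, i.e. $\mathrm{id}_k\otimes\mathcal{E}$ maps positive semidefinite matrices to positive semidefinite matrices for every $k$. A channel $\mathcal{E}$ is *infinitely divisible* if for every integer $n\ge 1$ there is a channel $\mathcal{E}_n$ with $\mathcal{E}=(\mathcal{E}_n)^n$ ($n$-fold composition). A linear map $L:M_d\to M_d$ has *Lindblad form* if $$L[\rho]=i[\rho,H]+\sum_{i,j}G_{ij}\Big(F_i\rho F_j^\dagger-\tfrac12\{F_j^\dagger F_i,\rho\}\Big)$$ for a Hermitian $H\in M_d$, a finite family $(F_i)$ in $M_d$ and a positive semidefinite matrix $G$. Let $\mathcal{L}_{\mathsf L}$ be the set of non-singular channels $\mathcal{E}$ such that $\mathcal{E}=e^{L}$ for some $L$ of Lindblad form; a channel is *L-divisible* if it belongs to the closure of $\mathcal{L}_{\mathsf L}$. A qubit channel ($d=2$) is a *Pauli channel* if $\mathcal{E}[\rho]=\sum_{i=0}^3p_i\sigma_i\rho\sigma_i$ with $p_i\ge0$, $\sum_ip_i=1$,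 where $\sigma_0=\mathbb{1}$ and $\sigma_1,\sigma_2,\sigma_3$ are the Pauli matrices. Write $\mathrm{diag}(v_0,v_1,v_2,v_3)$ for the linear map on $M_2$ with $\sigma_i\mapsto v_i\sigma_i$. **Theorem (Infinitely divisible Pauli channels).** The set of L-divisible Pauli channels is equal to the set of infinitely divisible Pauli channels. Moreover, the singular (non-invertible) infinitely divisible Pauli channels are exactly $\mathcal{N}=\mathrm{diag}(1,0,0,0)$ and, for $0<\lambda\le1$, $$\mathcal{E}_x^\lambda=\mathrm{diag}(1,\lambda,0,0),\quad \mathcal{E}_y^\lambda=\mathrm{diag}(1,0,\lambda,0),\quad \mathcal{E}_z^\lambda=\mathrm{diag}(1,0,0,\lambda),$$ and they are limits of the following explicit sequences in $\mathcal{L}_{\mathsf L}$: 1. for every $n\ge 0$ the map $L_n=\mathrm{diag}(0,-n,-n,-n)$ has Lindblad form and $e^{L_n}\in\mathcal{L}_{\mathsf L}$, and $e^{L_n}\to\mathcal{N}$ as $n\to\infty$; 2. for $0<\lambda\le1$ and every $n\ge1$ the map $\mathrm{diag}(1,\sqrt\lambda/n,\sqrt\lambda/n,\lambda)$ belongs to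 $\mathcal{L}_{\mathsf L}$, and these maps converge to $\mathcal{E}_z^\lambda$ as $n\to\infty$; likewise $\mathrm{diag}(1,\lambda,\sqrt\lambda/n,\sqrt\lambda/n)\to\mathcal{E}_x^\lambda$ and $\mathrm{diag}(1,\sqrt\lambda/n,\lambda,\sqrt\lambda/n)\to\mathcal{E}_y^\lambda$, with all terms in $\mathcal{L}_{\mathsf L}$. -/

import Mathlib

open scoped Matrix ComplexOrder Matrix.Norms.L2Operator

noncomputable section

namespace QuantumChannel

/-- Superoperators: linear maps on complex `d × d` matrices. In finite dimension all linear maps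
are continuous and all norms are equivalent, so bundling continuity and choosing the operator
norm on matrices only serve to provide the usual topology, the composition product and the
exponential. -/
abbrev SuperOp (d : ℕ) : Type :=
  Matrix (Fin d) (Fin d) ℂ →L[ℂ] Matrix (Fin d) (Fin d) ℂ

/-- The ampliation `id_k ⊗ E`, acting on operators on `ℂ^k ⊗ ℂ^d` seen as `k × k` block matrices
with `d × d` blocks: `E` is applied to each block. -/
def ampliation {d : ℕ} (k : ℕ) (E : SuperOp d)
    (X : Matrix (Fin k × Fin d) (Fin k × Fin d) ℂ) :
    Matrix (Fin k × Fin d) (Fin k × Fin d) ℂ :=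
  Matrix.of fun p q => E (Matrix.of fun i j => X (p.1, i) (q.1, j)) p.2 q.2

def IsCompletelyPositive {d : ℕ} (E : SuperOp d) : Prop :=
  ∀ (k : ℕ) (X : Matrix (Fin k × Fin d) (Fin k × Fin d) ℂ),
    X.PosSemidef → (ampliation k E X).PosSemidef

def IsTracePreserving {d : ℕ} (E : SuperOp d) : Prop :=
  ∀ X : Matrix (Fin d) (Fin d) ℂ, (E X).trace = X.trace

/-- Quantum channels: completely positive trace-preserving linear maps. -/
def IsChannel {d : ℕ} (E : SuperOp d) : Prop :=
  IsCompletelyPositive E ∧ IsTracePreserving E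

/-- Channels having a channel `n`-th root (for composition) for every positive integer `n`. -/
def IsInfinitelyDivisible {d : ℕ} (E : SuperOp d) : Prop :=
  IsChannel E ∧ ∀ n : ℕ, 0 < n → ∃ F : SuperOp d, IsChannel F ∧ E = F ^ n

/-- Lindblad form:
`L[ρ] = i[ρ, H] + ∑ i j, G i j (F i ρ (F j)† - ½ {(F j)† (F i), ρ})`
with `H` hermitian and `G ≥ 0`. -/
def HasLindbladForm {d : ℕ} (L : SuperOp d) : Prop :=
  ∃ (m : ℕ) (H : Matrix (Fin d) (Fin d) ℂ) (G : Matrix (Fin m) (Fin m) ℂ)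
    (F : Fin m → Matrix (Fin d) (Fin d) ℂ),
    H.IsHermitian ∧ G.PosSemidef ∧
    ∀ ρ : Matrix (Fin d) (Fin d) ℂ,
      L ρ = Complex.I • (ρ * H - H * ρ) +
        ∑ i, ∑ j, G i j •
          (F i * ρ * (F j)ᴴ -
            (1 / 2 : ℂ) • ((F j)ᴴ * F i * ρ + ρ * ((F j)ᴴ * F i)))

/-- The non-singular channels having a logarithm of Lindblad form. -/
def lindbladChannels (d : ℕ) : Set (SuperOp d) :=
  {E | IsChannel E ∧ IsUnit E ∧ ∃ L : SuperOp d, HasLindbladForm L ∧ NormedSpace.exp L = E}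

/-- L-divisible channels: those in the closure of `lindbladChannels d`. -/
def IsLDivisible {d : ℕ} (E : SuperOp d) : Prop :=
  IsChannel E ∧ E ∈ closure (lindbladChannels d)

/-- The matrices `1, σ_x, σ_y, σ_z`. -/
def pauli : Fin 4 → Matrix (Fin 2) (Fin 2) ℂ :=
  ![1, !![0, 1; 1, 0], !![0, -Complex.I; Complex.I, 0], !![1, 0; 0, -1]]

/-- Pauli channels: `ρ ↦ ∑ i, p i σ_i ρ σ_i` with `p` a probability vector. -/
def IsPauliChannel (E : SuperOp 2) : Prop :=
  ∃ p : Fin 4 → ℝ, (∀ i, 0 ≤ p i) ∧ ∑ i, p i = 1 ∧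
    ∀ ρ : Matrix (Fin 2) (Fin 2) ℂ,
      E ρ = ∑ i, (p i : ℂ) • (pauli i * ρ * pauli i)

/-- The superoperator with matrix `diag(v 0, v 1, v 2, v 3)` in the orthonormal Pauli basis
`σ_i / √2`, that is `X ↦ ∑ i, v i tr(σ_i X) σ_i / 2`. -/
def pauliDiag (v : Fin 4 → ℝ) : SuperOp 2 :=
  LinearMap.toContinuousLinearMap
    { toFun := fun X => ∑ i, ((v i : ℂ) * (pauli i * X).trace / 2) • pauli i
      map_add' := fun X Y => by
        simp only [mul_add, Matrix.trace_add, add_div, add_smul, Finset.sum_add_distrib]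
      map_smul' := fun c X => by
        simp only [Matrix.mul_smul, Matrix.trace_smul, smul_eq_mul, RingHom.id_apply,
          Finset.smul_sum, smul_smul]
        refine Finset.sum_congr rfl fun i _ => ?_
        congr 1
        ring }

/-- For an axis `a` of the Bloch sphere (`0, 1, 2` for `x, y, z`), the superoperator fixing `1`,
multiplying `σ_a` by `l` and the other two Pauli matrices by `e`. -/
def axisDiag (a : Fin 3) (l e : ℝ) : SuperOp 2 :=
  pauliDiag (Fin.cons 1 (Function.update (fun _ => e) a l))

end QuantumChannel

end

/-! A channel `exp L` with `L` of Lindblad form has the channel `exp (L / n)` as an `n`-th root.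
Channels form a compact set, since their Choi matrices are bounded, so the set of `n`-th powers of
channels is closed and contains the closure of the Lindblad exponentials. Hence L-divisibility
implies infinite divisibility in every dimension (`IsLDivisible.isInfinitelyDivisible`).

For the converse, a Pauli channel acts on Bloch vectors as `diagonal l`. The Bloch matrix `T` of an
`n`-th root commutes with it. If `l k` differs from the other two eigenvalues, row `k` of `T`
vanishes off the diagonal, so `T k k` and the complementary minor are `n`-th roots of `l k` and of
`l (k + 1) * l (k + 2)`. Complete positivity bounds four times the minor by `(1 + T k k) ^ 2`
(`IsChannel.four_mul_bloch_minor_le`), and letting `n` grow turns this into `l (k + 1) * l (k + 2) ≤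
l k` (`IsInfinitelyDivisible.mul_le_of_ne`).

For positive `l` these inequalities say exactly that the Pauli dissipator with eigenvalues `log (l
k)` has nonnegative rates. If some `l k` is negative and none is zero, the determinant and the same
lemma leave two equal negative eigenvalues, which a half turn about the third axis produces. If some
`l k` is zero, the inequalities leave at most one nonzero eigenvalue, which must be positive: these
are the singular channels, limits of the stated sequences. -/

noncomputable section

open Filter Topology

namespace QuantumChannel

/-! ### Powers converging to an exponential -/

section PowerLimit

variable {𝔸 : Type*} [NormedRing 𝔸] [NormOneClass 𝔸]

/-- Telescoping. The bound serves with `M = exp (c / n)`, for which `M ^ n` does not depend on `n`.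
-/
theorem norm_pow_sub_pow_le_of_norm_le {x y : 𝔸} {M : ℝ} (hM : 1 ≤ M) (hx : ‖x‖ ≤ M)
    (hy : ‖y‖ ≤ M) (n : ℕ) : ‖x ^ n - y ^ n‖ ≤ n * M ^ n * ‖x - y‖ := by
  have hM0 : 0 ≤ M := by linarith
  induction n with
  | zero => simp
  | succ n ih =>
    have e : x ^ (n + 1) - y ^ (n + 1) = x ^ n * (x - y) + (x ^ n - y ^ n) * y := by
      rw [pow_succ, pow_succ]; noncomm_ring
    have hxn : ‖x ^ n‖ ≤ M ^ (n + 1) :=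
      (norm_pow_le x n).trans ((pow_le_pow_left₀ (norm_nonneg _) hx n).trans
        (pow_le_pow_right₀ hM (Nat.le_succ n)))
    calc ‖x ^ (n + 1) - y ^ (n + 1)‖
        ≤ ‖x ^ n‖ * ‖x - y‖ + ‖x ^ n - y ^ n‖ * ‖y‖ := by
          rw [e]
          exact (norm_add_le _ _).trans (add_le_add (norm_mul_le _ _) (norm_mul_le _ _))
      _ ≤ M ^ (n + 1) * ‖x - y‖ + (n * M ^ n * ‖x - y‖) * M := by gcongr
      _ = (n + 1 : ℕ) * M ^ (n + 1) * ‖x - y‖ := by push_cast; ring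

/-- If `n (xₙ - 1)` and `n (yₙ - 1)` have the same limit, then `xₙ ^ n - yₙ ^ n` tends to zero. -/
theorem tendsto_pow_sub_pow_of_tendsto_nsmul_sub_one {x y : ℕ → 𝔸} {L : 𝔸}
    (hx : Tendsto (fun n => n • (x n - 1)) atTop (𝓝 L))
    (hy : Tendsto (fun n => n • (y n - 1)) atTop (𝓝 L))
    (hn : ∀ (n : ℕ) (a : 𝔸), ‖n • a‖ = n * ‖a‖) :
    Tendsto (fun n => x n ^ n - y n ^ n) atTop (𝓝 0) := by
  have bound : ∀ z : ℕ → 𝔸, Tendsto (fun n => n • (z n - 1)) atTop (𝓝 L) →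
      ∀ᶠ n in atTop, ‖z n‖ ≤ Real.exp ((‖L‖ + 1) / n) := by
    intro z hz
    have h1 : ∀ᶠ n in atTop, ‖n • (z n - 1)‖ < ‖L‖ + 1 :=
      hz.norm.eventually_lt_const (by linarith)
    filter_upwards [h1, eventually_gt_atTop 0] with n h2 h3
    have h3' : (0 : ℝ) < n := by exact_mod_cast h3
    rw [hn] at h2
    have h4 : ‖z n - 1‖ ≤ (‖L‖ + 1) / n := by
      rw [le_div_iff₀ h3']; linarith
    have h5 : ‖z n‖ ≤ ‖z n - 1‖ + 1 := by
      simpa using norm_add_le (z n - 1) 1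
    linarith [Real.add_one_le_exp ((‖L‖ + 1) / n)]
  have hxy : Tendsto (fun n => Real.exp (‖L‖ + 1) * ‖n • (x n - 1) - n • (y n - 1)‖) atTop
      (𝓝 0) := by
    have := ((hx.sub hy).norm).const_mul (Real.exp (‖L‖ + 1))
    simpa using this
  refine squeeze_zero_norm' ?_ hxy
  filter_upwards [bound x hx, bound y hy, eventually_gt_atTop 0] with n h1 h2 h3
  have h3' : (0 : ℝ) < n := by exact_mod_cast h3
  have h4 := norm_pow_sub_pow_le_of_norm_le (Real.one_le_exp (by positivity)) h1 h2 n
  have h5 : Real.exp ((‖L‖ + 1) / n) ^ n = Real.exp (‖L‖ + 1) := by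
    rw [← Real.exp_nat_mul]; congr 1; field_simp
  rw [h5] at h4
  have h6 : n • (x n - 1) - n • (y n - 1) = n • (x n - y n) := by
    rw [← nsmul_sub]; congr 1; abel
  rw [h6, hn]
  linarith

omit [NormOneClass 𝔸] in
theorem exp_inv_natCast_smul_pow [NormedAlgebra ℂ 𝔸] [CompleteSpace 𝔸] (L : 𝔸) {n : ℕ}
    (hn : n ≠ 0) : NormedSpace.exp ((n : ℂ)⁻¹ • L) ^ n = NormedSpace.exp L := by
  let _ : NormedAlgebra ℚ 𝔸 := NormedAlgebra.restrictScalars ℚ ℂ 𝔸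
  rw [← NormedSpace.exp_nsmul, ← Nat.cast_smul_eq_nsmul ℂ, smul_smul,
    mul_inv_cancel₀ (by exact_mod_cast hn), one_smul]

/-- Compare with `exp (L / n)`: its `n`-th power is `exp L`, and its first-order behaviour is the
derivative of `t ↦ exp (t L)` at `0`. -/
theorem tendsto_pow_exp [NormedAlgebra ℂ 𝔸] [CompleteSpace 𝔸] {x : ℕ → 𝔸} {L : 𝔸}
    (hx : Tendsto (fun n => n • (x n - 1)) atTop (𝓝 L)) :
    Tendsto (fun n => x n ^ n) atTop (𝓝 (NormedSpace.exp L)) := by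
  let _ : NormedAlgebra ℚ 𝔸 := NormedAlgebra.restrictScalars ℚ ℂ 𝔸
  have hn : ∀ (n : ℕ) (a : 𝔸), ‖n • a‖ = n * ‖a‖ := by
    intro n a
    rw [← Nat.cast_smul_eq_nsmul ℂ, norm_smul]; simp
  have hd : HasDerivAt (fun t : ℂ => NormedSpace.exp (t • L)) L 0 := by
    simpa using hasDerivAt_exp_smul_const (𝕂 := ℂ) L 0
  have hu : Tendsto (fun n : ℕ => ((n : ℂ))⁻¹) atTop (𝓝[≠] 0) := by
    refine tendsto_nhdsWithin_iff.2 ⟨tendsto_inv_atTop_nhds_zero_nat (𝕜 := ℂ), ?_⟩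
    filter_upwards [eventually_gt_atTop 0] with n h
    simpa using h.ne'
  have hs := (hasDerivAt_iff_tendsto_slope.1 hd).comp hu
  have hy : Tendsto (fun n : ℕ => n • (NormedSpace.exp ((n : ℂ)⁻¹ • L) - 1)) atTop (𝓝 L) := by
    refine hs.congr fun n => ?_
    simp [slope, ← Nat.cast_smul_eq_nsmul ℂ]
  have h0 := tendsto_pow_sub_pow_of_tendsto_nsmul_sub_one hx hy hn
  have h1 : Tendsto (fun n : ℕ => x n ^ n - NormedSpace.exp ((n : ℂ)⁻¹ • L) ^ n
      + NormedSpace.exp L) atTop (𝓝 (NormedSpace.exp L)) := by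
    simpa using h0.add_const (NormedSpace.exp L)
  refine h1.congr' ?_
  filter_upwards [eventually_gt_atTop 0] with n h
  rw [exp_inv_natCast_smul_pow L h.ne']; abel

end PowerLimit

/-- An eigenvector of `L` is an eigenvector of `exp L`. -/
theorem exp_apply_of_apply_eq_smul {d : ℕ} {L : SuperOp d} {X : Matrix (Fin d) (Fin d) ℂ} {c : ℂ}
    (h : L X = c • X) : NormedSpace.exp L X = Complex.exp c • X := by
  have h1 := (NormedSpace.exp_series_hasSum_exp' (𝕂 := ℂ) L).mapL
    (ContinuousLinearMap.apply ℂ (Matrix (Fin d) (Fin d) ℂ) X)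
  have hp : ∀ n : ℕ, (L ^ n) X = c ^ n • X := by
    intro n
    induction n with
    | zero => simp
    | succ n ih => rw [pow_succ, mul_apply_eq_comp, h, map_smul, ih, smul_smul, pow_succ']
  have h2 := (NormedSpace.exp_series_hasSum_exp' (𝕂 := ℂ) c).smul_const X
  rw [← Complex.exp_eq_exp_ℂ] at h2
  refine h1.unique ?_
  convert! h2 using 1
  ext1 n
  simp [hp, smul_smul]

/-! ### Stability and closedness of the channel conditions -/

section CompletePositivity

variable {d : ℕ}

/-- The map `X ↦ A X B`. -/
def sandwich (A B : Matrix (Fin d) (Fin d) ℂ) : SuperOp d :=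
  LinearMap.toContinuousLinearMap (LinearMap.mulLeft ℂ A ∘ₗ LinearMap.mulRight ℂ B)

@[simp] theorem sandwich_apply (A B X : Matrix (Fin d) (Fin d) ℂ) :
    sandwich A B X = A * X * B := by
  simp [sandwich, Matrix.mul_assoc]

theorem ampliation_sandwich (k : ℕ) (A B : Matrix (Fin d) (Fin d) ℂ)
    (X : Matrix (Fin k × Fin d) (Fin k × Fin d) ℂ) :
    ampliation k (sandwich A B) X =
      Matrix.kronecker (1 : Matrix (Fin k) (Fin k) ℂ) A * X *
        Matrix.kronecker (1 : Matrix (Fin k) (Fin k) ℂ) B := by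
  ext ⟨p, i⟩ ⟨q, j⟩
  simp [ampliation, Matrix.mul_apply, Matrix.kronecker, Matrix.kroneckerMap_apply,
    Fintype.sum_prod_type, Matrix.one_apply, Finset.sum_mul, ite_mul]

theorem isCompletelyPositive_sandwich (A : Matrix (Fin d) (Fin d) ℂ) :
    IsCompletelyPositive (sandwich A Aᴴ) := by
  intro k X hX
  rw [ampliation_sandwich]
  have : Matrix.kronecker (1 : Matrix (Fin k) (Fin k) ℂ) Aᴴ =
      (Matrix.kronecker (1 : Matrix (Fin k) (Fin k) ℂ) A)ᴴ := by
    simp [Matrix.conjTranspose_kronecker]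
  rw [this]
  exact hX.mul_mul_conjTranspose_same _

theorem IsCompletelyPositive.add {E F : SuperOp d} (hE : IsCompletelyPositive E)
    (hF : IsCompletelyPositive F) : IsCompletelyPositive (E + F) := by
  intro k X hX
  have : ampliation k (E + F) X = ampliation k E X + ampliation k F X := by
    ext; simp [ampliation]
  rw [this]
  exact (hE k X hX).add (hF k X hX)

theorem IsCompletelyPositive.smul {E : SuperOp d} (hE : IsCompletelyPositive E) {c : ℂ}
    (hc : 0 ≤ c) : IsCompletelyPositive (c • E) := by
  intro k X hX
  have : ampliation k (c • E) X = c • ampliation k E X := by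
    ext; simp [ampliation]
  rw [this]
  exact (hE k X hX).smul hc

theorem isCompletelyPositive_zero : IsCompletelyPositive (0 : SuperOp d) := by
  intro k X _
  have : ampliation k (0 : SuperOp d) X = 0 := by
    ext; simp [ampliation]
  rw [this]
  exact Matrix.PosSemidef.zero

theorem isCompletelyPositive_sum {ι : Type*} (s : Finset ι) {E : ι → SuperOp d}
    (h : ∀ i ∈ s, IsCompletelyPositive (E i)) : IsCompletelyPositive (∑ i ∈ s, E i) :=
  Finset.sum_induction E IsCompletelyPositive (fun _ _ ha hb => ha.add hb)
    isCompletelyPositive_zero h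

theorem IsCompletelyPositive.mul {E F : SuperOp d} (hE : IsCompletelyPositive E)
    (hF : IsCompletelyPositive F) : IsCompletelyPositive (E * F) :=
  fun k X hX => hE k _ (hF k X hX)

theorem isCompletelyPositive_one : IsCompletelyPositive (1 : SuperOp d) := fun _ _ hX => hX

theorem IsCompletelyPositive.pow {E : SuperOp d} (hE : IsCompletelyPositive E) (n : ℕ) :
    IsCompletelyPositive (E ^ n) := by
  induction n with
  | zero => exact isCompletelyPositive_one
  | succ n ih => rw [pow_succ]; exact ih.mul hE

theorem isClosed_setOf_posSemidef {n : Type*} [Fintype n] :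
    IsClosed {X : Matrix n n ℂ | X.PosSemidef} := by
  simp only [Matrix.posSemidef_iff_dotProduct_mulVec, Set.ofPred_and, Set.ofPred_forall]
  refine IsClosed.inter ?_ (isClosed_iInter fun x => ?_)
  · exact isClosed_eq (by fun_prop) (by fun_prop)
  · exact isClosed_le continuous_const (by fun_prop)

theorem isClosed_setOf_isCompletelyPositive :
    IsClosed {E : SuperOp d | IsCompletelyPositive E} := by
  simp only [IsCompletelyPositive, Set.ofPred_forall]
  refine isClosed_iInter fun k => isClosed_iInter fun X => isClosed_iInter fun _ => ?_
  refine isClosed_setOf_posSemidef.preimage (f := fun E : SuperOp d => ampliation k E X) ?_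
  refine continuous_pi fun p => continuous_pi fun q => ?_
  have h1 : Continuous fun E : SuperOp d => E (Matrix.of fun i j => X (p.1, i) (q.1, j)) :=
    (ContinuousLinearMap.apply ℂ _ _).continuous
  exact (continuous_apply_apply p.2 q.2).comp h1

theorem isClosed_setOf_isTracePreserving :
    IsClosed {E : SuperOp d | IsTracePreserving E} := by
  simp only [IsTracePreserving, Set.ofPred_forall]
  refine isClosed_iInter fun X => isClosed_eq ?_ continuous_const
  exact (ContinuousLinearMap.apply ℂ _ X).continuous.matrix_trace

theorem isClosed_setOf_isChannel : IsClosed {E : SuperOp d | IsChannel E} :=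
  isClosed_setOf_isCompletelyPositive.inter isClosed_setOf_isTracePreserving

theorem IsTracePreserving.pow {E : SuperOp d} (hE : IsTracePreserving E) (n : ℕ) :
    IsTracePreserving (E ^ n) := by
  induction n with
  | zero => exact fun _ => rfl
  | succ n ih =>
    intro X
    rw [pow_succ, mul_apply_eq_comp, ih, hE]

theorem IsChannel.pow {E : SuperOp d} (hE : IsChannel E) (n : ℕ) : IsChannel (E ^ n) :=
  ⟨hE.1.pow n, hE.2.pow n⟩

end CompletePositivity

/-! ### Lindblad generators exponentiate to channels -/

section Lindblad

variable {d : ℕ}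

-- Factoring `G = Bᴴ * B` turns the double sum into a Kraus sum.
open scoped MatrixOrder in
theorem isCompletelyPositive_sum_smul_sandwich {m : ℕ} {G : Matrix (Fin m) (Fin m) ℂ}
    (hG : G.PosSemidef) (F : Fin m → Matrix (Fin d) (Fin d) ℂ) :
    IsCompletelyPositive (∑ i, ∑ j, G i j • sandwich (F i) (F j)ᴴ) := by
  obtain ⟨B, rfl⟩ : ∃ B : Matrix (Fin m) (Fin m) ℂ, G = Bᴴ * B :=
    CStarAlgebra.nonneg_iff_eq_star_mul_self.1 hG.nonneg
  have h : ∑ i, ∑ j, (Bᴴ * B) i j • sandwich (F i) (F j)ᴴ =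
      ∑ k, sandwich (∑ i, star (B k i) • F i) (∑ i, star (B k i) • F i)ᴴ := by
    ext1 ρ
    simp only [sum_apply, smul_apply, sandwich_apply,
      Matrix.mul_apply, Matrix.conjTranspose_apply, Matrix.conjTranspose_sum,
      Matrix.conjTranspose_smul, star_star, Finset.sum_mul, Finset.mul_sum, Finset.sum_smul,
      Matrix.smul_mul, Matrix.mul_smul, smul_smul]
    rw [Finset.sum_comm_cycle]
    refine Finset.sum_congr rfl fun k _ => ?_
    rw [Finset.sum_comm]
    refine Finset.sum_congr rfl fun i _ => Finset.sum_congr rfl fun j _ => ?_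
    rw [mul_comm]
  rw [h]
  exact isCompletelyPositive_sum _ fun k _ => isCompletelyPositive_sandwich _

/-- A map of Lindblad form is the sum of a completely positive map and of `ρ ↦ M ρ + ρ M†`. -/
theorem HasLindbladForm.exists_eq_add {L : SuperOp d} (hL : HasLindbladForm L) :
    ∃ (Φ : SuperOp d) (M : Matrix (Fin d) (Fin d) ℂ), IsCompletelyPositive Φ ∧
      L = Φ + sandwich M 1 + sandwich 1 Mᴴ := by
  obtain ⟨m, H, G, F, hH, hG, h⟩ := hL
  refine ⟨∑ i, ∑ j, G i j • sandwich (F i) (F j)ᴴ,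
    -- The Hamiltonian and anticommutator terms combine into `M ρ + ρ M†`, as `H` and the double sum
    -- are both Hermitian.
    -(Complex.I • H) - (1 / 2 : ℂ) • ∑ i, ∑ j, G i j • ((F j)ᴴ * F i),
    isCompletelyPositive_sum_smul_sandwich hG F, ?_⟩
  have hS : (∑ i, ∑ j, G i j • ((F j)ᴴ * F i))ᴴ = ∑ i, ∑ j, G i j • ((F j)ᴴ * F i) := by
    simp only [Matrix.conjTranspose_sum, Matrix.conjTranspose_smul, Matrix.conjTranspose_mul,
      Matrix.conjTranspose_conjTranspose, hG.isHermitian.apply]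
    exact Finset.sum_comm
  have hM : (-(Complex.I • H) - (1 / 2 : ℂ) • ∑ i, ∑ j, G i j • ((F j)ᴴ * F i))ᴴ =
      Complex.I • H - (1 / 2 : ℂ) • ∑ i, ∑ j, G i j • ((F j)ᴴ * F i) := by
    rw [Matrix.conjTranspose_sub, Matrix.conjTranspose_smul, hS, Matrix.conjTranspose_neg,
      Matrix.conjTranspose_smul, hH.eq]
    simp
  rw [hM]
  ext1 ρ
  rw [h]
  simp only [add_apply, sum_apply,
    smul_apply, sandwich_apply, Matrix.mul_one, Matrix.one_mul,
    smul_sub, Finset.sum_sub_distrib, Matrix.sub_mul, Matrix.mul_sub, Matrix.neg_mul,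
    Matrix.smul_mul, Matrix.mul_smul, Finset.sum_mul, Finset.mul_sum, smul_add,
    Finset.sum_add_distrib, Finset.smul_sum]
  simp only [smul_comm _ (1 / 2 : ℂ)]
  abel

theorem HasLindbladForm.trace_apply {L : SuperOp d} (hL : HasLindbladForm L)
    (X : Matrix (Fin d) (Fin d) ℂ) : (L X).trace = 0 := by
  obtain ⟨m, H, G, F, hH, hG, h⟩ := hL
  rw [h]
  simp only [Matrix.trace_add, Matrix.trace_smul, Matrix.trace_sub, Matrix.trace_sum]
  rw [Matrix.trace_mul_comm X H, sub_self, smul_zero, zero_add]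
  refine Finset.sum_eq_zero fun i _ => Finset.sum_eq_zero fun j _ => ?_
  rw [Matrix.trace_mul_comm X, Matrix.trace_mul_comm (F i * X), Matrix.mul_assoc]
  simp only [smul_eq_mul]
  ring

theorem HasLindbladForm.smul {L : SuperOp d} (hL : HasLindbladForm L) {r : ℝ} (hr : 0 ≤ r) :
    HasLindbladForm ((r : ℂ) • L) := by
  obtain ⟨m, H, G, F, hH, hG, h⟩ := hL
  refine ⟨m, (r : ℂ) • H, (r : ℂ) • G, F, ?_, hG.smul (by exact_mod_cast hr), fun ρ => ?_⟩
  · rw [Matrix.IsHermitian, Matrix.conjTranspose_smul, hH.eq]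
    simp
  · rw [smul_apply, h, smul_add]
    simp only [Finset.smul_sum, Matrix.smul_apply, smul_eq_mul, Matrix.mul_smul, Matrix.smul_mul,
      mul_smul, ← smul_sub, smul_comm Complex.I (r : ℂ)]

instance instNormOneClassSuperOp [NeZero d] : NormOneClass (SuperOp d) := by
  have : Nonempty (Fin d) := ⟨0⟩
  exact ContinuousLinearMap.normOneClass

/-- A map of Lindblad form generates a semigroup of channels. -/
theorem HasLindbladForm.isChannel_exp [NeZero d] {L : SuperOp d} (hL : HasLindbladForm L) :
    IsChannel (NormedSpace.exp L) := by
  constructor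
  · obtain ⟨Φ, M, hΦ, rfl⟩ := hL.exists_eq_add
    -- A completely positive first-order approximation of `exp (L / n)`: completing `1 + (M · + ·
    -- M†) / n` to a sandwich costs only `M · M† / n²`.
    let A : ℕ → SuperOp d := fun n =>
      sandwich (1 + (n : ℂ)⁻¹ • M) (1 + (n : ℂ)⁻¹ • M)ᴴ + (n : ℂ)⁻¹ • Φ
    have hA : ∀ n, IsCompletelyPositive (A n) := fun n =>
      (isCompletelyPositive_sandwich _).add (hΦ.smul (by positivity))
    have hlim : Tendsto (fun n => n • (A n - 1)) atTop
        (𝓝 (Φ + sandwich M 1 + sandwich 1 Mᴴ)) := by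
      have h1 : Tendsto (fun n : ℕ => (n : ℂ)⁻¹ • sandwich M Mᴴ +
          (Φ + sandwich M 1 + sandwich 1 Mᴴ)) atTop
          (𝓝 (Φ + sandwich M 1 + sandwich 1 Mᴴ)) := by
        have := ((tendsto_inv_atTop_nhds_zero_nat (𝕜 := ℂ)).smul_const
          (sandwich M Mᴴ)).add_const (Φ + sandwich M 1 + sandwich 1 Mᴴ)
        rwa [zero_smul ℂ (sandwich M Mᴴ), zero_add] at this
      refine h1.congr' ?_
      filter_upwards [eventually_gt_atTop 0] with n hn
      have hn' : (n : ℂ) ≠ 0 := by exact_mod_cast hn.ne'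
      rw [← Nat.cast_smul_eq_nsmul ℂ]
      ext1 ρ
      simp only [A, add_apply, smul_apply,
        sub_apply, sandwich_apply, Matrix.conjTranspose_add,
        Matrix.conjTranspose_one, Matrix.conjTranspose_smul, Matrix.mul_add, Matrix.add_mul,
        Matrix.mul_one, Matrix.one_mul, Matrix.smul_mul, Matrix.mul_smul, smul_add, smul_sub,
        smul_smul, star_inv₀, star_natCast, mul_inv_cancel₀ hn', one_smul,
        one_apply_eq_self]
      rw [← mul_assoc, mul_inv_cancel₀ hn', one_mul]
      abel
    have := tendsto_pow_exp (𝔸 := SuperOp d) hlim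
    exact isClosed_setOf_isCompletelyPositive.mem_of_tendsto this
      (Eventually.of_forall fun n => (hA n).pow n)
  -- Only the trace matters here, so the plain Euler step suffices; it need not be completely
  -- positive.
  · let A : ℕ → SuperOp d := fun n => 1 + (n : ℂ)⁻¹ • L
    have hA : ∀ n, IsTracePreserving (A n) := fun n X => by
      simp [A, hL.trace_apply]
    have hlim : Tendsto (fun n => n • (A n - 1)) atTop (𝓝 L) := by
      refine tendsto_const_nhds.congr' ?_
      filter_upwards [eventually_gt_atTop 0] with n hn
      have hn' : (n : ℂ) ≠ 0 := by exact_mod_cast hn.ne'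
      simp [A, ← Nat.cast_smul_eq_nsmul ℂ, smul_smul, hn']
    exact isClosed_setOf_isTracePreserving.mem_of_tendsto (tendsto_pow_exp (𝔸 := SuperOp d) hlim)
      (Eventually.of_forall fun n => (hA n).pow n)

theorem HasLindbladForm.exp_mem_lindbladChannels [NeZero d] {L : SuperOp d}
    (hL : HasLindbladForm L) : NormedSpace.exp L ∈ lindbladChannels d :=
  let _ : NormedAlgebra ℚ (SuperOp d) := NormedAlgebra.restrictScalars ℚ ℂ (SuperOp d)
  ⟨hL.isChannel_exp, NormedSpace.isUnit_exp L, L, hL, rfl⟩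

theorem exists_isChannel_pow_eq_of_mem_lindbladChannels [NeZero d] {E : SuperOp d}
    (hE : E ∈ lindbladChannels d) {n : ℕ} (hn : 0 < n) :
    ∃ F : SuperOp d, IsChannel F ∧ F ^ n = E := by
  obtain ⟨-, -, L, hL, rfl⟩ := hE
  refine ⟨NormedSpace.exp ((((n : ℝ)⁻¹ : ℝ) : ℂ) • L),
    (hL.smul (by positivity)).isChannel_exp, ?_⟩
  have h := exp_inv_natCast_smul_pow L hn.ne'
  rwa [← Complex.ofReal_natCast, ← Complex.ofReal_inv] at h

end Lindblad

/-! ### Choi matrices and compactness of the set of channels -/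

section Choi

variable {d : ℕ}

/-- The Choi matrix of a linear map. -/
def choi (E : SuperOp d) : Matrix (Fin d × Fin d) (Fin d × Fin d) ℂ :=
  Matrix.of fun p q => E (Matrix.single p.1 q.1 1) p.2 q.2

theorem IsCompletelyPositive.posSemidef_choi {E : SuperOp d} (hE : IsCompletelyPositive E) :
    (choi E).PosSemidef := by
  -- The unnormalised maximally entangled vector; the ampliation sends its projector to the Choi
  -- matrix.
  let w : Fin d × Fin d → ℂ := fun p => if p.1 = p.2 then 1 else 0
  have h := hE d _ (Matrix.posSemidef_vecMulVec_self_star w)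
  convert h using 1
  refine Matrix.ext fun p q => ?_
  simp only [choi, ampliation, Matrix.of_apply]
  refine congrArg (fun Y => E Y p.2 q.2) (Matrix.ext fun i j => ?_)
  by_cases h1 : p.1 = i <;> by_cases h2 : q.1 = j <;>
    simp [Matrix.single, Matrix.vecMulVec_apply, w, h1, h2]

theorem norm_apply_le_of_posSemidef {n : Type*} [Fintype n] [DecidableEq n] {C : Matrix n n ℂ}
    (hC : C.PosSemidef) (p q : n) : ‖C p q‖ ≤ ((C p p).re + (C q q).re) / 2 := by
  -- The phase `u` rotates `C p q` onto the nonnegative reals; positivity is then tested on `star u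
  -- • e_p - e_q`.
  obtain ⟨u, hu, hu'⟩ : ∃ u : ℂ, u * C p q = ‖C p q‖ ∧ star u * u = 1 := by
    by_cases h : C p q = 0
    · exact ⟨1, by simp [h], by simp⟩
    · have h' : (‖C p q‖ : ℂ) ≠ 0 := by simpa using h
      have h2 := Complex.conj_mul' (C p q)
      refine ⟨star (C p q) / ‖C p q‖, ?_, ?_⟩
      · rw [div_mul_eq_mul_div, div_eq_iff h', Complex.star_def, h2]; ring
      · simp only [Complex.star_def, map_div₀, Complex.conj_conj, Complex.conj_ofReal]
        field_simp
        rw [mul_comm, h2]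
  have hherm : C q p = star (C p q) := (hC.isHermitian.apply q p).symm
  have hu2 : star u * C q p = ‖C p q‖ := by
    rw [hherm, ← star_mul', hu]; simp
  have h := hC.dotProduct_mulVec_nonneg (Pi.single p (star u) - Pi.single q 1)
  have e : star (Pi.single p (star u) - Pi.single q 1) ⬝ᵥ
      (C *ᵥ (Pi.single p (star u) - Pi.single q 1)) =
      (star u * u) * C p p - u * C p q - star u * C q p + C q q := by
    simp [Matrix.mulVec_sub, sub_dotProduct, dotProduct_sub]
    ring
  rw [e, hu', hu, hu2, one_mul] at h
  have h' := (Complex.le_def.1 h).1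
  simp only [Complex.zero_re, Complex.add_re, Complex.sub_re, Complex.ofReal_re] at h'
  linarith

/-- The diagonal is nonnegative and, by trace preservation, sums to `d`; positivity bounds the
remaining entries by it. -/
theorem IsChannel.norm_choi_apply_le {E : SuperOp d} (hE : IsChannel E) (p q : Fin d × Fin d) :
    ‖choi E p q‖ ≤ d := by
  have hC := hE.1.posSemidef_choi
  have hnn : ∀ p, 0 ≤ (choi E p p).re := fun p => (Complex.le_def.1 hC.diag_nonneg).1
  have htr : ∑ p, (choi E p p).re = d := by
    rw [← Complex.re_sum, Fintype.sum_prod_type]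
    have : ∀ i : Fin d, ∑ j, choi E (i, j) (i, j) = 1 := fun i => by
      have := hE.2 (Matrix.single i i 1)
      rw [Matrix.trace_single_eq_same] at this
      exact this
    simp [this]
  have hle : ∀ p, (choi E p p).re ≤ d := fun p =>
    htr ▸ Finset.single_le_sum (fun q _ => hnn q) (Finset.mem_univ p)
  have := norm_apply_le_of_posSemidef hC p q
  linarith [hle p, hle q]

/-- `choi` is linear and injective, so a continuous linear left inverse carries a compact box of
matrices onto a set containing the closed set of channels. -/
theorem isCompact_setOf_isChannel : IsCompact {E : SuperOp d | IsChannel E} := by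
  let f : SuperOp d →ₗ[ℂ] (Fin d × Fin d → Fin d × Fin d → ℂ) :=
    { toFun := fun E => choi E
      map_add' := fun E F => by ext; simp [choi]; rfl
      map_smul' := fun c E => by ext; simp [choi]; rfl }
  have hf : LinearMap.ker f = ⊥ := by
    refine LinearMap.ker_eq_bot'.2 fun E hE => ?_
    have h : ∀ i j, E (Matrix.single i j 1) = 0 := fun i j => by
      ext k l
      exact congrFun (congrFun hE (i, k)) (j, l)
    ext1 X
    rw [Matrix.matrix_eq_sum_single X, map_sum, zero_apply]
    simp only [map_sum]
    refine Finset.sum_eq_zero fun i _ => Finset.sum_eq_zero fun j _ => ?_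
    have : Matrix.single i j (X i j) = X i j • Matrix.single i j (1 : ℂ) := by simp
    rw [this, map_smul, h]; simp
  obtain ⟨g, hg⟩ := f.exists_leftInverse_of_injective hf
  have hgc : Continuous g := g.continuous_of_finiteDimensional
  let S : Set (Fin d × Fin d → Fin d × Fin d → ℂ) :=
    Set.pi Set.univ fun _ => Set.pi Set.univ fun _ => Metric.closedBall 0 d
  have hS : IsCompact S := isCompact_univ_pi fun _ => isCompact_univ_pi fun _ =>
    isCompact_closedBall 0 (d : ℝ)
  refine (hS.image hgc).of_isClosed_subset isClosed_setOf_isChannel fun E hE => ?_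
  refine ⟨f E, fun p _ q _ => ?_, LinearMap.congr_fun hg E⟩
  rw [mem_closedBall_zero_iff]
  exact IsChannel.norm_choi_apply_le hE p q

/-- Compactness makes the set of `n`-th powers of channels closed, so roots survive passage to the
closure. -/
theorem IsLDivisible.isInfinitelyDivisible [NeZero d] {E : SuperOp d} (hE : IsLDivisible E) :
    IsInfinitelyDivisible E := by
  refine ⟨hE.1, fun n hn => ?_⟩
  have hK : IsCompact ((fun F : SuperOp d => F ^ n) '' {F | IsChannel F}) :=
    isCompact_setOf_isChannel.image (continuous_pow n)
  have hsub : lindbladChannels d ⊆ (fun F : SuperOp d => F ^ n) '' {F | IsChannel F} :=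
    fun F hF => exists_isChannel_pow_eq_of_mem_lindbladChannels hF hn
  obtain ⟨F, hF, h⟩ := closure_minimal hsub hK.isClosed hE.2
  exact ⟨F, hF, h.symm⟩

end Choi

/-! ### Pauli matrices and Pauli channels -/

section Pauli

theorem pauli_mul_self (i : Fin 4) : pauli i * pauli i = 1 := by
  fin_cases i <;> simp [pauli, Matrix.one_fin_two]

theorem isHermitian_pauli (i : Fin 4) : (pauli i).IsHermitian := by
  fin_cases i <;> ext a b <;> fin_cases a <;> fin_cases b <;> simp [pauli]

theorem trace_pauli_mul_pauli (i j : Fin 4) :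
    (pauli i * pauli j).trace = if i = j then 2 else 0 := by
  fin_cases i <;> fin_cases j <;>
    simp [pauli, Matrix.trace_fin_two, Matrix.one_fin_two] <;> norm_num

theorem trace_pauli_succ (i : Fin 3) : (pauli i.succ).trace = 0 := by
  fin_cases i <;> simp [pauli, Matrix.trace_fin_two]

theorem pauli_mul_pauli_cyclic (k : Fin 3) :
    pauli (k + 1).succ * pauli (k + 2).succ = Complex.I • pauli k.succ := by
  fin_cases k <;> ext a b <;> fin_cases a <;> fin_cases b <;> simp [pauli]

theorem pauli_mul_pauli_cyclic' (k : Fin 3) :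
    pauli (k + 2).succ * pauli (k + 1).succ = -(Complex.I • pauli k.succ) := by
  fin_cases k <;> ext a b <;> fin_cases a <;> fin_cases b <;> simp [pauli]

theorem pauliDiag_apply (v : Fin 4 → ℝ) (X : Matrix (Fin 2) (Fin 2) ℂ) :
    pauliDiag v X = ∑ i, ((v i : ℂ) * (pauli i * X).trace / 2) • pauli i := rfl

theorem pauliDiag_pauli (v : Fin 4 → ℝ) (i : Fin 4) :
    pauliDiag v (pauli i) = (v i : ℂ) • pauli i := by
  rw [pauliDiag_apply, Finset.sum_eq_single i]
  · rw [trace_pauli_mul_pauli]; simp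
  · intro j _ hj
    rw [trace_pauli_mul_pauli, if_neg hj]; simp
  · simp

theorem sum_pauli_eq (X : Matrix (Fin 2) (Fin 2) ℂ) :
    ∑ i, ((pauli i * X).trace / 2) • pauli i = X := by
  ext a b
  fin_cases a <;> fin_cases b <;>
    simp [pauli, Fin.sum_univ_four, Matrix.trace_fin_two, Matrix.mul_apply, Fin.sum_univ_two] <;> ring_nf <;> simp only [Complex.I_sq] <;> ring

theorem superOp_ext_pauli {E F : SuperOp 2} (h : ∀ i, E (pauli i) = F (pauli i)) : E = F := by
  refine ContinuousLinearMap.ext fun X => ?_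
  rw [← sum_pauli_eq X]
  simp only [map_sum, map_smul, h]

theorem superOp_ext_pauli' {E F : SuperOp 2} (h0 : E 1 = F 1)
    (h : ∀ i : Fin 3, E (pauli i.succ) = F (pauli i.succ)) : E = F :=
  superOp_ext_pauli (Fin.cases h0 h)

theorem IsPauliChannel.isChannel {E : SuperOp 2} (hE : IsPauliChannel E) : IsChannel E := by
  obtain ⟨p, hp, hp1, h⟩ := hE
  constructor
  · have : E = ∑ i, (p i : ℂ) • sandwich (pauli i) (pauli i)ᴴ := by
      ext1 X
      simp [h, (isHermitian_pauli _).eq]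
    rw [this]
    exact isCompletelyPositive_sum _ fun i _ =>
      (isCompletelyPositive_sandwich _).smul (by exact_mod_cast hp i)
  · intro X
    rw [h, Matrix.trace_sum]
    have : ∀ i, ((p i : ℂ) • (pauli i * X * pauli i)).trace = p i * X.trace := fun i => by
      rw [Matrix.trace_smul, Matrix.trace_mul_comm, ← mul_assoc, pauli_mul_self, one_mul,
        smul_eq_mul]
    simp only [this, ← Finset.sum_mul]
    rw [← Complex.ofReal_sum, hp1]
    simp

/-- Conjugation by a Pauli matrix fixes those commuting with it and negates the others. No sign or
normalisation of `p` is assumed, so the formula also serves for generators. -/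
theorem sum_pauli_conj_eq_pauliDiag (p : Fin 4 → ℝ) (X : Matrix (Fin 2) (Fin 2) ℂ) :
    ∑ i, (p i : ℂ) • (pauli i * X * pauli i) =
      pauliDiag ![p 0 + p 1 + p 2 + p 3, p 0 + p 1 - p 2 - p 3, p 0 - p 1 + p 2 - p 3,
        p 0 - p 1 - p 2 + p 3] X := by
  rw [pauliDiag_apply, Matrix.eta_fin_two X]
  generalize X 0 0 = a, X 0 1 = b, X 1 0 = c, X 1 1 = d
  have hI := Complex.I_sq
  ext i j
  fin_cases i <;> fin_cases j <;>
    simp [pauli, Fin.sum_univ_four, Matrix.trace_fin_two, Matrix.mul_apply, Fin.sum_univ_two]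
  · linear_combination (-p 2 * d) * hI
  · linear_combination (p 2 * c - (p 0 - p 1 + p 2 - p 3) * (c - b) / 2) * hI
  · linear_combination (p 2 * b + (p 0 - p 1 + p 2 - p 3) * (c - b) / 2) * hI
  · linear_combination (-p 2 * a) * hI

/-- The superoperator fixing `1` with `σ_i ↦ l i σ_i`. -/
abbrev unitalDiag (l : Fin 3 → ℝ) : SuperOp 2 := pauliDiag (Fin.cons 1 l)

theorem IsPauliChannel.exists_eq_unitalDiag {E : SuperOp 2} (hE : IsPauliChannel E) :
    ∃ l : Fin 3 → ℝ, E = unitalDiag l ∧ ∀ i, |l i| ≤ 1 := by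
  obtain ⟨p, hp, hp1, h⟩ := hE
  refine ⟨![p 0 + p 1 - p 2 - p 3, p 0 - p 1 + p 2 - p 3, p 0 - p 1 - p 2 + p 3], ?_, ?_⟩
  · ext1 X
    rw [h, sum_pauli_conj_eq_pauliDiag, ← Fin.sum_univ_four, hp1]
    rfl
  · rw [Fin.sum_univ_four] at hp1
    intro i
    have := hp 0
    have := hp 1
    have := hp 2
    have := hp 3
    fin_cases i <;> simp [abs_le] <;> constructor <;> linarith

theorem isPauliChannel_unitalDiag {l : Fin 3 → ℝ} (h0 : 0 ≤ 1 + l 0 + l 1 + l 2)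
    (h1 : 0 ≤ 1 + l 0 - l 1 - l 2) (h2 : 0 ≤ 1 - l 0 + l 1 - l 2)
    (h3 : 0 ≤ 1 - l 0 - l 1 + l 2) : IsPauliChannel (unitalDiag l) := by
  refine ⟨![(1 + l 0 + l 1 + l 2) / 4, (1 + l 0 - l 1 - l 2) / 4, (1 - l 0 + l 1 - l 2) / 4,
    (1 - l 0 - l 1 + l 2) / 4], ?_, ?_, fun X => ?_⟩
  · intro i
    fin_cases i <;> simp <;> linarith
  · rw [Fin.sum_univ_four]
    simp
    ring
  · rw [sum_pauli_conj_eq_pauliDiag]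
    refine congrArg (fun v => pauliDiag v X) (funext fun i => ?_)
    refine Fin.cases ?_ (fun i => ?_) i
    · simp
      ring
    · rw [Fin.cons_succ]
      fin_cases i <;> simp <;> ring

end Pauli

/-! ### Bloch matrices and a consequence of complete positivity -/

section Bloch

theorem IsCompletelyPositive.map_conjTranspose {d : ℕ} {E : SuperOp d}
    (hE : IsCompletelyPositive E) (X : Matrix (Fin d) (Fin d) ℂ) : E Xᴴ = (E X)ᴴ := by
  have h : ∀ i j, E (Matrix.single j i 1) = (E (Matrix.single i j 1))ᴴ := fun i j => by
    ext k l
    exact (hE.posSemidef_choi.isHermitian.apply (j, k) (i, l)).symm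
  rw [Matrix.matrix_eq_sum_single X]
  simp only [map_sum, Matrix.conjTranspose_sum]
  refine Finset.sum_congr rfl fun i _ => Finset.sum_congr rfl fun j _ => ?_
  have h1 : Matrix.single i j (X i j) = X i j • Matrix.single i j (1 : ℂ) := by simp
  rw [h1, Matrix.conjTranspose_smul, map_smul, map_smul, Matrix.conjTranspose_smul, ← h,
    Matrix.conjTranspose_single, star_one]

/-- The matrix of a channel on the Bloch vectors. -/
def bloch (F : SuperOp 2) : Matrix (Fin 3) (Fin 3) ℝ :=
  Matrix.of fun i j => ((pauli i.succ * F (pauli j.succ)).trace / 2).re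

theorem IsChannel.apply_pauli_succ {F : SuperOp 2} (hF : IsChannel F) (j : Fin 3) :
    F (pauli j.succ) = ∑ i : Fin 3, (bloch F i j : ℂ) • pauli i.succ := by
  have hherm : (F (pauli j.succ)).IsHermitian := by
    rw [Matrix.IsHermitian, ← hF.1.map_conjTranspose, (isHermitian_pauli _).eq]
  have hre : ∀ i : Fin 3, (bloch F i j : ℂ) = (pauli i.succ * F (pauli j.succ)).trace / 2 := by
    intro i
    refine Complex.conj_eq_iff_re.1 ?_
    rw [map_div₀, ← Complex.star_def, ← Matrix.trace_conjTranspose, Matrix.conjTranspose_mul,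
      hherm.eq, (isHermitian_pauli _).eq, Matrix.trace_mul_comm]
    simp
  conv_lhs => rw [← sum_pauli_eq (F (pauli j.succ)), Fin.sum_univ_succ]
  have h0 : (pauli 0 * F (pauli j.succ)).trace = 0 := by
    have : pauli 0 = 1 := rfl
    rw [this, one_mul, hF.2, trace_pauli_succ]
  rw [h0]
  simp [hre]

/-- `G` sends traceless Pauli matrices to real combinations of such, so a non-unital part of `F`
never enters. -/
theorem IsChannel.bloch_mul {F G : SuperOp 2} (hG : IsChannel G) :
    bloch (F * G) = bloch F * bloch G := by
  ext i j
  rw [Matrix.mul_apply]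
  change ((pauli i.succ * F (G (pauli j.succ))).trace / 2).re =
    ∑ k, ((pauli i.succ * F (pauli k.succ)).trace / 2).re * bloch G k j
  rw [hG.apply_pauli_succ]
  simp only [map_sum, map_smul, Matrix.mul_sum, Matrix.trace_sum, Matrix.mul_smul,
    Matrix.trace_smul, smul_eq_mul, Finset.sum_div, Complex.re_sum, mul_div_assoc,
    Complex.re_ofReal_mul]
  exact Finset.sum_congr rfl fun k _ => mul_comm _ _

theorem bloch_pauliDiag (v : Fin 4 → ℝ) :
    bloch (pauliDiag v) = Matrix.diagonal fun i => v i.succ := by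
  ext i j
  simp only [bloch, Matrix.of_apply, pauliDiag_pauli, Matrix.mul_smul, Matrix.trace_smul,
    trace_pauli_mul_pauli, Matrix.diagonal_apply, Fin.succ_inj]
  by_cases h : i = j <;> simp [h]

theorem bloch_one : bloch 1 = 1 := by
  ext i j
  simp only [bloch, Matrix.of_apply, one_apply_eq_self, trace_pauli_mul_pauli, Fin.succ_inj,
    Matrix.one_apply]
  by_cases h : i = j <;> simp [h]

theorem IsChannel.bloch_pow {F : SuperOp 2} (hF : IsChannel F) (n : ℕ) :
    bloch (F ^ n) = bloch F ^ n := by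
  induction n with
  | zero => simpa using bloch_one
  | succ n ih => rw [pow_succ, pow_succ, hF.bloch_mul, ih]

theorem IsCompletelyPositive.norm_dotProduct_le {d : ℕ} {F : SuperOp d}
    (hF : IsCompletelyPositive F) (f g : Fin d → ℂ) :
    ‖star f ⬝ᵥ F (Matrix.vecMulVec f (star g)) *ᵥ g‖ ≤
      ((star f ⬝ᵥ F (Matrix.vecMulVec f (star f)) *ᵥ f).re +
        (star g ⬝ᵥ F (Matrix.vecMulVec g (star g)) *ᵥ g).re) / 2 := by
  -- Apply `id_2 ⊗ F` to the projector on the stacked vector `(f, g)`, then compress by `B` to a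
  -- positive `2 × 2` matrix whose off-diagonal entry is the one to be bounded.
  let u : Fin 2 → Fin d → ℂ := ![f, g]
  have h1 := hF 2 _ (Matrix.posSemidef_vecMulVec_self_star fun p : Fin 2 × Fin d => u p.1 p.2)
  let B : Matrix (Fin 2 × Fin d) (Fin 2) ℂ := Matrix.of fun p q => if p.1 = q then u q p.2 else 0
  have h2 := h1.conjTranspose_mul_mul_same B
  have key : ∀ p q, (Bᴴ * ampliation 2 F (Matrix.vecMulVec (fun p : Fin 2 × Fin d => u p.1 p.2)
      (star fun p : Fin 2 × Fin d => u p.1 p.2)) * B) p q =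
      star (u p) ⬝ᵥ F (Matrix.vecMulVec (u p) (star (u q))) *ᵥ (u q) := by
    intro p q
    rw [Matrix.mul_assoc]
    simp only [Matrix.mul_apply, B, Fintype.sum_prod_type, Matrix.conjTranspose_apply,
      Matrix.of_apply, apply_ite star, star_zero, ite_mul, mul_ite, zero_mul, mul_zero,
      Finset.sum_ite_irrel, Finset.sum_const_zero, Finset.sum_ite_eq', Finset.mem_univ, if_true,
      dotProduct, Matrix.mulVec, Pi.star_apply]
    rfl
  have := norm_apply_le_of_posSemidef h2 0 1
  rw [key, key, key] at this
  exact this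

/-- The squared modulus of `(T i i + T j j) + (T i j - T j i) I` is four times the minor plus `(T i
i - T j j) ^ 2 + (T i j + T j i) ^ 2`. -/
theorem IsChannel.four_mul_bloch_minor_le_of_dotProduct_eq {F : SuperOp 2} (hF : IsChannel F)
    {k i j : Fin 3} {f g : Fin 2 → ℂ} {c : ℂ} (hc : c ≠ 0)
    (hfg : star f ⬝ᵥ F (Matrix.vecMulVec f (star g)) *ᵥ g =
      c * ((bloch F i i + bloch F j j : ℝ) + (bloch F i j - bloch F j i : ℝ) * Complex.I))
    (hff : star f ⬝ᵥ F (Matrix.vecMulVec f (star f)) *ᵥ f +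
        star g ⬝ᵥ F (Matrix.vecMulVec g (star g)) *ᵥ g =
      ((2 * ‖c‖ * (1 + bloch F k k) : ℝ) : ℂ)) :
    4 * (bloch F i i * bloch F j j - bloch F i j * bloch F j i) ≤ (1 + bloch F k k) ^ 2 := by
  have h := hF.1.norm_dotProduct_le f g
  rw [← Complex.add_re, hff, hfg, Complex.ofReal_re, norm_mul] at h
  have h1 : ‖((bloch F i i + bloch F j j : ℝ) : ℂ) +
      (bloch F i j - bloch F j i : ℝ) * Complex.I‖ ≤ 1 + bloch F k k := by
    refine le_of_mul_le_mul_left ?_ (norm_pos_iff.2 hc)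
    linarith
  have h2 := pow_le_pow_left₀ (norm_nonneg _) h1 2
  rw [Complex.sq_norm, Complex.normSq_add_mul_I] at h2
  nlinarith [sq_nonneg (bloch F i i - bloch F j j), sq_nonneg (bloch F i j + bloch F j i)]

/-- The principal `2 × 2` minors of the Bloch matrix of a channel. -/
theorem IsChannel.four_mul_bloch_minor_le {F : SuperOp 2} (hF : IsChannel F) (k : Fin 3) :
    4 * (bloch F (k + 1) (k + 1) * bloch F (k + 2) (k + 2) -
      bloch F (k + 1) (k + 2) * bloch F (k + 2) (k + 1)) ≤ (1 + bloch F k k) ^ 2 := by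
  -- `F` need not be unital; only the trace of `F 1` is used. In each case `f` and `g` are the two
  -- eigenvectors of the `k`-th Pauli matrix, unnormalised for `x` and `y`, whence `c = 2` there and
  -- `c = 1 / 2` for `z`.
  obtain ⟨A, hA⟩ : ∃ A, F 1 = A := ⟨_, rfl⟩
  have htr : A 0 0 + A 1 1 = 2 := by
    rw [← Matrix.trace_fin_two, ← hA, hF.2]; simp
  have hx := hF.apply_pauli_succ 0
  have hy := hF.apply_pauli_succ 1
  have hz := hF.apply_pauli_succ 2
  simp only [Fin.sum_univ_three] at hx hy hz
  fin_cases k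
  · have e1 : Matrix.vecMulVec ![1, 1] (star ![1, -1]) =
        -Complex.I • (pauli (Fin.succ 1) + Complex.I • pauli (Fin.succ 2)) := by
      ext a b; fin_cases a <;> fin_cases b <;> simp [pauli, Matrix.vecMulVec_apply]
    have e2 : Matrix.vecMulVec ![1, 1] (star ![1, 1]) = 1 + pauli (Fin.succ 0) := by
      ext a b; fin_cases a <;> fin_cases b <;> simp [pauli, Matrix.vecMulVec_apply]
    have e3 : Matrix.vecMulVec ![1, -1] (star ![1, -1]) = 1 - pauli (Fin.succ 0) := by
      ext a b; fin_cases a <;> fin_cases b <;> simp [pauli, Matrix.vecMulVec_apply]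
    refine hF.four_mul_bloch_minor_le_of_dotProduct_eq (f := ![1, 1]) (g := ![1, -1]) (c := 2)
      two_ne_zero ?_ ?_
    · rw [e1, map_smul, map_add, map_smul, hy, hz]
      simp [pauli, dotProduct, Matrix.mulVec, Fin.sum_univ_two, mul_add]
      ring_nf
      simp only [Complex.I_sq]
      linear_combination (-2 * Complex.I * (bloch F 1 2 : ℂ)) * Complex.I_sq
    · rw [e2, e3, map_add, map_sub, hA, hx]
      simp [pauli, dotProduct, Matrix.mulVec, Fin.sum_univ_two]
      linear_combination 2 * htr
  · have e1 : Matrix.vecMulVec ![1, Complex.I] (star ![1, -Complex.I]) =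
        pauli (Fin.succ 2) + Complex.I • pauli (Fin.succ 0) := by
      ext a b; fin_cases a <;> fin_cases b <;> simp [pauli, Matrix.vecMulVec_apply]
    have e2 : Matrix.vecMulVec ![1, Complex.I] (star ![1, Complex.I]) = 1 + pauli (Fin.succ 1) := by
      ext a b; fin_cases a <;> fin_cases b <;> simp [pauli, Matrix.vecMulVec_apply]
    have e3 : Matrix.vecMulVec ![1, -Complex.I] (star ![1, -Complex.I]) =
        1 - pauli (Fin.succ 1) := by
      ext a b; fin_cases a <;> fin_cases b <;> simp [pauli, Matrix.vecMulVec_apply]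
    refine hF.four_mul_bloch_minor_le_of_dotProduct_eq (f := ![1, Complex.I])
      (g := ![1, -Complex.I]) (c := 2) two_ne_zero ?_ ?_
    · rw [e1, map_add, map_smul, hx, hz]
      simp [pauli, dotProduct, Matrix.mulVec, Fin.sum_univ_two, mul_add]
      ring_nf
      simp [Complex.I_sq]
      ring
    · rw [e2, e3, map_add, map_sub, hA, hy]
      simp [pauli, dotProduct, Matrix.mulVec, Fin.sum_univ_two]
      ring_nf
      simp [Complex.I_sq]
      linear_combination 2 * htr
  · have e1 : Matrix.vecMulVec ![1, 0] (star ![0, 1]) =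
        (1 / 2 : ℂ) • (pauli (Fin.succ 0) + Complex.I • pauli (Fin.succ 1)) := by
      ext a b; fin_cases a <;> fin_cases b <;> simp [pauli, Matrix.vecMulVec_apply]; norm_num
    have e2 : Matrix.vecMulVec ![1, 0] (star ![1, 0]) =
        (1 / 2 : ℂ) • (1 + pauli (Fin.succ 2)) := by
      ext a b; fin_cases a <;> fin_cases b <;> simp [pauli, Matrix.vecMulVec_apply]; norm_num
    have e3 : Matrix.vecMulVec ![0, 1] (star ![0, 1]) =
        (1 / 2 : ℂ) • (1 - pauli (Fin.succ 2)) := by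
      ext a b; fin_cases a <;> fin_cases b <;> simp [pauli, Matrix.vecMulVec_apply]; norm_num
    refine hF.four_mul_bloch_minor_le_of_dotProduct_eq (f := ![1, 0])
      (g := ![0, 1]) (c := 1 / 2) (by norm_num) ?_ ?_
    · rw [e1, map_smul, map_add, map_smul, hx, hy]
      simp [pauli, dotProduct, Matrix.mulVec, Fin.sum_univ_two, mul_add]
      ring_nf
      simp only [Complex.I_sq]
      ring
    · rw [e2, e3, map_smul, map_smul, map_add, map_sub, hA, hz]
      simp [pauli, dotProduct, Matrix.mulVec, Fin.sum_univ_two]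
      linear_combination (1 / 2) * htr

end Bloch

/-- For `q > 0`, `log a ≤ 2 log ((1 + s) / 2) ≤ s - 1 ≤ s log s`. Multiplying by `n` gives `log p ≤
s log q`, and `s = q ^ (1 / n)` tends to `1`. For `q = 0`, `s = 0` and `p ≤ (1 / 4) ^ n`. -/
theorem le_of_forall_exists_root {p q : ℝ} (hp : 0 ≤ p)
    (h : ∀ n : ℕ, 0 < n → ∃ a s : ℝ, 0 ≤ a ∧ 0 ≤ s ∧ a ^ n = p ∧ s ^ n = q ∧
      4 * a ≤ (1 + s) ^ 2) : p ≤ q := by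
  have hq : 0 ≤ q := by
    obtain ⟨a, s, -, hs, -, rfl, -⟩ := h 1 one_pos
    positivity
  rcases hp.eq_or_lt with rfl | hp
  · exact hq
  rcases hq.eq_or_lt with rfl | hq
  · have h1 : Tendsto (fun n : ℕ => (1 / 4 : ℝ) ^ n) atTop (𝓝 0) :=
      tendsto_pow_atTop_nhds_zero_of_lt_one (by norm_num) (by norm_num)
    refine ge_of_tendsto h1 ?_
    filter_upwards [eventually_gt_atTop 0] with n hn
    obtain ⟨a, s, ha, hs, rfl, hsq, has⟩ := h n hn
    obtain rfl : s = 0 := by simpa using (pow_eq_zero_iff hn.ne').1 hsq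
    exact pow_le_pow_left₀ ha (by linarith) n
  · refine (Real.log_le_log_iff hp hq).1 ?_
    have hlim : Tendsto (fun n : ℕ => Real.log q * Real.exp (Real.log q / n)) atTop
        (𝓝 (Real.log q)) := by
      have h1 : Tendsto (fun n : ℕ => Real.log q / n) atTop (𝓝 0) :=
        tendsto_const_div_atTop_nhds_zero_nat _
      simpa using ((Real.continuous_exp.tendsto 0).comp h1).const_mul (Real.log q)
    refine ge_of_tendsto hlim ?_
    filter_upwards [eventually_gt_atTop 0] with n hn
    obtain ⟨a, s, ha, hs, hap, hsq, has⟩ := h n hn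
    have hn' : (0 : ℝ) < n := by exact_mod_cast hn
    have ha' : 0 < a := ha.lt_of_ne fun h0 => by
      rw [← h0, zero_pow hn.ne'] at hap; exact hp.ne hap
    have hs' : 0 < s := hs.lt_of_ne fun h0 => by
      rw [← h0, zero_pow hn.ne'] at hsq; exact hq.ne hsq
    have hlp : Real.log p = n * Real.log a := by rw [← hap, Real.log_pow]
    have hlq : Real.log q = n * Real.log s := by rw [← hsq, Real.log_pow]
    have hexp : Real.exp (Real.log q / n) = s := by
      rw [hlq, mul_div_cancel_left₀ _ hn'.ne', Real.exp_log hs']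
    have h1 : Real.log a ≤ s - 1 := by
      have h2 : a ≤ ((1 + s) / 2) ^ 2 := by linarith
      calc Real.log a ≤ Real.log (((1 + s) / 2) ^ 2) := Real.log_le_log ha' h2
        _ = 2 * Real.log ((1 + s) / 2) := by rw [Real.log_pow]; norm_num
        _ ≤ 2 * ((1 + s) / 2 - 1) := by
          gcongr; exact Real.log_le_sub_one_of_pos (by positivity)
        _ = s - 1 := by ring
    have h2 : s - 1 ≤ s * Real.log s := by
      have h3 := Real.log_le_sub_one_of_pos (inv_pos.2 hs')
      rw [Real.log_inv] at h3
      have h4 := mul_le_mul_of_nonneg_left h3 hs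
      rw [mul_sub, mul_inv_cancel₀ hs'.ne'] at h4
      linarith
    rw [hexp, hlp, hlq]
    nlinarith

/-! ### Matrix roots of a diagonal matrix -/

section BlockDiagonal

/-- Commuting with a diagonal matrix forces entries between distinct eigenvalues to vanish. -/
theorem apply_eq_zero_of_pow_eq_diagonal {T : Matrix (Fin 3) (Fin 3) ℝ} {l : Fin 3 → ℝ} {n : ℕ}
    (h : T ^ n = Matrix.diagonal l) {i j : Fin 3} (hij : l i ≠ l j) : T i j = 0 := by
  have h1 : T * Matrix.diagonal l = Matrix.diagonal l * T := by
    rw [← h, ← pow_succ, ← pow_succ']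
  have h2 := congrFun (congrFun h1 i) j
  rw [Matrix.mul_diagonal, Matrix.diagonal_mul] at h2
  have h3 : (l i - l j) * T i j = 0 := by linarith
  exact (mul_eq_zero.1 h3).resolve_left (sub_ne_zero.2 hij)

theorem fin_three_sum_cyclic {M : Type*} [AddCommMonoid M] (f : Fin 3 → M) (k : Fin 3) :
    ∑ i, f i = f k + f (k + 1) + f (k + 2) := by
  rw [Fin.sum_univ_three]
  fin_cases k
  · rfl
  · change _ = f 1 + f 2 + f 0
    abel
  · change _ = f 2 + f 0 + f 1
    abel

/-- The minor of a matrix complementary to the diagonal entry `k`. -/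
def complMinor (k : Fin 3) (T : Matrix (Fin 3) (Fin 3) ℝ) : ℝ :=
  T (k + 1) (k + 1) * T (k + 2) (k + 2) - T (k + 1) (k + 2) * T (k + 2) (k + 1)

/-- Such a `T` is block triangular, so the entry at `k` and the determinant of the complementary
block are both multiplicative; the rest of column `k` is irrelevant. -/
theorem pow_apply_and_complMinor_pow {T : Matrix (Fin 3) (Fin 3) ℝ} {k : Fin 3}
    (h1 : T k (k + 1) = 0) (h2 : T k (k + 2) = 0) (n : ℕ) :
    ((T ^ n) k (k + 1) = 0 ∧ (T ^ n) k (k + 2) = 0) ∧ (T ^ n) k k = T k k ^ n ∧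
      complMinor k (T ^ n) = complMinor k T ^ n := by
  have hk1 : k ≠ k + 1 := by fin_cases k <;> decide
  have hk2 : k ≠ k + 2 := by fin_cases k <;> decide
  have hk3 : k + 1 ≠ k + 2 := by fin_cases k <;> decide
  induction n with
  | zero => simp [complMinor, hk1, hk2, hk3, hk3.symm]
  | succ n ih =>
    obtain ⟨⟨i1, i2⟩, i3, i4⟩ := ih
    refine ⟨⟨?_, ?_⟩, ?_, ?_⟩
    · rw [pow_succ, Matrix.mul_apply, fin_three_sum_cyclic _ k, i1, i2, h1]; ring
    · rw [pow_succ, Matrix.mul_apply, fin_three_sum_cyclic _ k, i1, i2, h2]; ring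
    · rw [pow_succ, Matrix.mul_apply, fin_three_sum_cyclic _ k, i1, i2, i3]; ring
    · rw [pow_succ (complMinor k T), ← i4, pow_succ]
      simp only [complMinor, Matrix.mul_apply, fin_three_sum_cyclic _ k, h1, h2]
      ring

end BlockDiagonal

/-! ### Eigenvalue inequalities forced by infinite divisibility -/

section Divisibility

variable {l : Fin 3 → ℝ}

theorem IsInfinitelyDivisible.exists_bloch_pow (hE : IsInfinitelyDivisible (unitalDiag l)) {n : ℕ}
    (hn : 0 < n) : ∃ F : SuperOp 2, IsChannel F ∧ bloch F ^ n = Matrix.diagonal l := by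
  obtain ⟨F, hF, h⟩ := hE.2 n hn
  refine ⟨F, hF, ?_⟩
  rw [← hF.bloch_pow, ← h, bloch_pauliDiag]
  simp

/-- A square root already makes the determinant a square. -/
theorem IsInfinitelyDivisible.mul_nonneg (hE : IsInfinitelyDivisible (unitalDiag l)) :
    0 ≤ l 0 * l 1 * l 2 := by
  obtain ⟨F, -, h⟩ := hE.exists_bloch_pow two_pos
  have h1 := congrArg Matrix.det h
  rw [Matrix.det_pow, Matrix.det_diagonal, Fin.prod_univ_three] at h1
  rw [← h1]
  positivity

theorem complMinor_diagonal (k : Fin 3) (l : Fin 3 → ℝ) :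
    complMinor k (Matrix.diagonal l) = l (k + 1) * l (k + 2) := by
  simp [complMinor]

theorem IsInfinitelyDivisible.mul_le_of_ne (hE : IsInfinitelyDivisible (unitalDiag l)) {k : Fin 3}
    (h1 : l k ≠ l (k + 1)) (h2 : l k ≠ l (k + 2)) :
    0 ≤ l (k + 1) * l (k + 2) ∧ l (k + 1) * l (k + 2) ≤ l k := by
  have key : ∀ n : ℕ, 0 < n → ∃ a s : ℝ, 0 ≤ a ∧ 0 ≤ s ∧ a ^ n = l (k + 1) * l (k + 2) ∧
      s ^ n = l k ∧ 4 * a ≤ (1 + s) ^ 2 := by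
    intro n hn
    -- A `2 n`-th root is taken so that the `n`-th root `G ^ 2` has a nonnegative entry and minor,
    -- being squares.
    obtain ⟨G, hG, h⟩ := hE.exists_bloch_pow (n := 2 * n) (by omega)
    have hpow := pow_apply_and_complMinor_pow (T := bloch G) (k := k)
      (apply_eq_zero_of_pow_eq_diagonal h h1) (apply_eq_zero_of_pow_eq_diagonal h h2)
    obtain ⟨-, h3, h4⟩ := hpow (2 * n)
    obtain ⟨-, h5, h6⟩ := hpow 2
    refine ⟨complMinor k (bloch G) ^ 2, bloch G k k ^ 2, by positivity, by positivity, ?_, ?_, ?_⟩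
    · rw [← pow_mul, ← h4, h, complMinor_diagonal]
    · rw [← pow_mul, ← h3, h, Matrix.diagonal_apply_eq]
    · have := (hG.pow 2).four_mul_bloch_minor_le k
      rw [hG.bloch_pow] at this
      rw [← h5, ← h6]
      exact this
  obtain ⟨a, -, ha, -, h3, -⟩ := key 1 one_pos
  have h4 : 0 ≤ l (k + 1) * l (k + 2) := by rw [← h3]; positivity
  exact ⟨h4, le_of_forall_exists_root h4 key⟩

end Divisibility

/-! ### Lindblad generators of Pauli channels -/

section Generators

open Complex in
/-- The generator `ρ ↦ i [ρ, H]` of a unitary evolution. -/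
def hamiltonian (H : Matrix (Fin 2) (Fin 2) ℂ) : SuperOp 2 := I • (sandwich 1 H - sandwich H 1)

theorem hamiltonian_apply (H X : Matrix (Fin 2) (Fin 2) ℂ) :
    hamiltonian H X = Complex.I • (X * H - H * X) := by
  simp [hamiltonian]

theorem hasLindbladForm_pauliDiag_add_hamiltonian {m : Fin 3 → ℝ}
    (hm : ∀ k, m (k + 1) + m (k + 2) ≤ m k) {H : Matrix (Fin 2) (Fin 2) ℂ} (hH : H.IsHermitian) :
    HasLindbladForm (pauliDiag (Fin.cons 0 m) + hamiltonian H) := by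
  -- The rates solve `m k = -2 (g (k + 1) + g (k + 2))`, where the right side is the eigenvalue on
  -- the `k`-th Pauli matrix of `X ↦ ∑ g i (σ_i X σ_i - X)`.
  let g : Fin 3 → ℝ := fun k => (m k - m (k + 1) - m (k + 2)) / 4
  have hg : ∀ k, 0 ≤ g k := fun k => by have := hm k; simp only [g]; linarith
  refine ⟨3, H, Matrix.diagonal fun k => (g k : ℂ), fun k => pauli k.succ, hH,
    Matrix.PosSemidef.diagonal fun k => by simpa using hg k, fun X => ?_⟩
  rw [add_apply, hamiltonian_apply, add_comm]
  congr 1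
  have h1 : ∀ i j : Fin 3, (Matrix.diagonal fun k => (g k : ℂ)) i j •
      (pauli i.succ * X * (pauli j.succ)ᴴ - (1 / 2 : ℂ) •
        ((pauli j.succ)ᴴ * pauli i.succ * X + X * ((pauli j.succ)ᴴ * pauli i.succ))) =
      if i = j then (g i : ℂ) • (pauli i.succ * X * pauli i.succ - X) else 0 := by
    intro i j
    by_cases h : i = j
    · subst h
      rw [if_pos rfl, Matrix.diagonal_apply_eq, (isHermitian_pauli _).eq, pauli_mul_self, one_mul,
        mul_one, ← two_smul ℂ X, smul_smul]
      norm_num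
    · rw [if_neg h, Matrix.diagonal_apply_ne _ h, zero_smul]
  simp only [h1, Finset.sum_ite_eq, Finset.mem_univ, if_true]
  -- The weight on the identity is minus the total rate, which absorbs the terms `-X`.
  have h2 := sum_pauli_conj_eq_pauliDiag (Fin.cons (-(g 0 + g 1 + g 2)) g) X
  rw [Fin.sum_univ_succ] at h2
  have h3 : ∑ i, (g i : ℂ) • (pauli i.succ * X * pauli i.succ - X) =
      ((-(g 0 + g 1 + g 2) : ℝ) : ℂ) • (pauli 0 * X * pauli 0) +
        ∑ i : Fin 3, (g i : ℂ) • (pauli i.succ * X * pauli i.succ) := by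
    have : pauli 0 = 1 := rfl
    simp only [smul_sub, Finset.sum_sub_distrib, this, one_mul, mul_one, ← Finset.sum_smul,
      Fin.sum_univ_three]
    push_cast
    rw [neg_smul]
    abel
  rw [h3]
  refine Eq.trans ?_ h2.symm
  refine congrArg (fun v => pauliDiag v X) (funext fun i => ?_)
  fin_cases i
  · change (0 : ℝ) = -(g 0 + g 1 + g 2) + g 0 + g 1 + g 2
    ring
  · change m 0 = -(g 0 + g 1 + g 2) + g 0 - g 1 - g 2
    change m 0 = -((m 0 - m 1 - m 2) / 4 + (m 1 - m 2 - m 0) / 4 + (m 2 - m 0 - m 1) / 4) +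
      (m 0 - m 1 - m 2) / 4 - (m 1 - m 2 - m 0) / 4 - (m 2 - m 0 - m 1) / 4
    ring
  · change m 1 = -((m 0 - m 1 - m 2) / 4 + (m 1 - m 2 - m 0) / 4 + (m 2 - m 0 - m 1) / 4) -
      (m 0 - m 1 - m 2) / 4 + (m 1 - m 2 - m 0) / 4 - (m 2 - m 0 - m 1) / 4
    ring
  · change m 2 = -((m 0 - m 1 - m 2) / 4 + (m 1 - m 2 - m 0) / 4 + (m 2 - m 0 - m 1) / 4) -
      (m 0 - m 1 - m 2) / 4 - (m 1 - m 2 - m 0) / 4 + (m 2 - m 0 - m 1) / 4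
    ring

theorem hasLindbladForm_pauliDiag {m : Fin 3 → ℝ} (hm : ∀ k, m (k + 1) + m (k + 2) ≤ m k) :
    HasLindbladForm (pauliDiag (Fin.cons 0 m)) := by
  have h := hasLindbladForm_pauliDiag_add_hamiltonian hm (H := 0) Matrix.isHermitian_zero
  have h0 : hamiltonian 0 = 0 := by ext1 X; rw [hamiltonian_apply]; simp
  rwa [h0, add_zero] at h

theorem exp_pauliDiag (v : Fin 4 → ℝ) :
    NormedSpace.exp (pauliDiag v) = pauliDiag fun i => Real.exp (v i) := by
  refine superOp_ext_pauli fun i => ?_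
  rw [exp_apply_of_apply_eq_smul (pauliDiag_pauli v i), pauliDiag_pauli, Complex.ofReal_exp]

theorem exp_pauliDiag_cons (m : Fin 3 → ℝ) :
    NormedSpace.exp (pauliDiag (Fin.cons 0 m)) = unitalDiag fun i => Real.exp (m i) := by
  rw [exp_pauliDiag]
  refine congrArg pauliDiag (funext fun i => Fin.cases ?_ (fun i => ?_) i) <;> simp

theorem unitalDiag_mem_lindbladChannels {l : Fin 3 → ℝ} (hpos : ∀ k, 0 < l k)
    (h : ∀ k, l (k + 1) * l (k + 2) ≤ l k) : unitalDiag l ∈ lindbladChannels 2 := by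
  have hL : HasLindbladForm (pauliDiag (Fin.cons 0 fun k => Real.log (l k))) := by
    refine hasLindbladForm_pauliDiag fun k => ?_
    rw [← Real.log_mul (hpos _).ne' (hpos _).ne']
    exact Real.log_le_log (mul_pos (hpos _) (hpos _)) (h k)
  have := hL.exp_mem_lindbladChannels
  rw [exp_pauliDiag_cons] at this
  simpa only [Real.exp_log (hpos _)] using this

/-- Unital diagonal maps with two equal negative eigenvalues are reached by adding the generator of
a half turn about the remaining axis. -/
theorem unitalDiag_mem_lindbladChannels_of_neg {l : Fin 3 → ℝ} {k : Fin 3} (hk : 0 < l k)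
    (hk1 : l k ≤ 1) (heq : l (k + 1) = l (k + 2)) (hneg : l (k + 1) < 0)
    (h : l (k + 1) * l (k + 2) ≤ l k) : unitalDiag l ∈ lindbladChannels 2 := by
  -- `Real.log` is the logarithm of the absolute value, so this dissipator produces `|l i|`; the
  -- Hamiltonian supplies the signs.
  let m : Fin 3 → ℝ := fun i => Real.log (l i)
  have hmeq : m (k + 2) = m (k + 1) := by simp only [m, heq]
  have hm : ∀ i, m (i + 1) + m (i + 2) ≤ m i := by
    have hm0 : m k ≤ 0 := Real.log_nonpos hk.le hk1
    have hm1 : m (k + 1) + m (k + 2) ≤ m k := by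
      simp only [m]
      rw [← Real.log_mul hneg.ne (heq ▸ hneg.ne)]
      exact Real.log_le_log (mul_pos_of_neg_of_neg hneg (heq ▸ hneg)) h
    intro i
    obtain rfl | rfl | rfl : i = k ∨ i = k + 1 ∨ i = k + 2 := by
      fin_cases k <;> fin_cases i <;> decide
    · exact hm1
    · have e1 : k + 1 + 1 = k + 2 := by fin_cases k <;> rfl
      have e2 : k + 1 + 2 = k := by fin_cases k <;> rfl
      rw [e1, e2]; linarith
    · have e1 : k + 2 + 1 = k := by fin_cases k <;> rfl
      have e2 : k + 2 + 2 = k + 1 := by fin_cases k <;> rfl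
      rw [e1, e2]; linarith
  -- This Hamiltonian rotates the plane orthogonal to axis `k` by angle `π` in unit time.
  let H : Matrix (Fin 2) (Fin 2) ℂ := ((Real.pi / 2 : ℝ) : ℂ) • pauli k.succ
  have hH : H.IsHermitian := by
    simp only [H, Matrix.IsHermitian, Matrix.conjTranspose_smul, (isHermitian_pauli _).eq,
      Complex.star_def, Complex.conj_ofReal]
  have hL := hasLindbladForm_pauliDiag_add_hamiltonian hm hH
  have hmem := hL.exp_mem_lindbladChannels
  suffices he : NormedSpace.exp (pauliDiag (Fin.cons 0 m) + hamiltonian H) = unitalDiag l by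
    rwa [he] at hmem
  have hdiag : ∀ i : Fin 3, pauliDiag (Fin.cons 0 m) (pauli i.succ) = (m i : ℂ) • pauli i.succ :=
    fun i => by rw [pauliDiag_pauli, Fin.cons_succ]
  have hz : (pauliDiag (Fin.cons 0 m) + hamiltonian H) 1 = (0 : ℂ) • 1 := by
    have : pauliDiag (Fin.cons 0 m) 1 = 0 := by
      have := pauliDiag_pauli (Fin.cons 0 m) 0
      rw [Fin.cons_zero, Complex.ofReal_zero, zero_smul] at this
      exact this
    rw [add_apply, this, hamiltonian_apply]
    simp
  have hkk : (pauliDiag (Fin.cons 0 m) + hamiltonian H) (pauli k.succ) =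
      (m k : ℂ) • pauli k.succ := by
    rw [add_apply, hdiag, hamiltonian_apply]
    simp [H]
  have e1 := pauli_mul_pauli_cyclic (k + 1)
  have e2 := pauli_mul_pauli_cyclic' (k + 1)
  have e3 := pauli_mul_pauli_cyclic (k + 2)
  have e4 := pauli_mul_pauli_cyclic' (k + 2)
  have a1 : k + 1 + 1 = k + 2 := by fin_cases k <;> rfl
  have a2 : k + 1 + 2 = k := by fin_cases k <;> rfl
  have a3 : k + 2 + 1 = k := by fin_cases k <;> rfl
  have a4 : k + 2 + 2 = k + 1 := by fin_cases k <;> rfl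
  rw [a1, a2] at e1 e2
  rw [a3, a4] at e3 e4
  have hI := Complex.I_sq
  have h1 : hamiltonian H (pauli (k + 1).succ) = (Real.pi : ℂ) • pauli (k + 2).succ := by
    rw [hamiltonian_apply, Matrix.mul_smul, Matrix.smul_mul, e3, e4]
    match_scalars
    linear_combination (-(Real.pi : ℂ)) * hI
  have h2 : hamiltonian H (pauli (k + 2).succ) = -((Real.pi : ℂ) • pauli (k + 1).succ) := by
    rw [hamiltonian_apply, Matrix.mul_smul, Matrix.smul_mul, e1, e2]
    match_scalars
    linear_combination (Real.pi : ℂ) * hI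
  -- On the plane the generator has eigenvectors `σ_{k+1} ± I σ_{k+2}` with eigenvalues `m (k + 1) ∓
  -- π I`, both exponentiating to `-|l (k + 1)| = l (k + 1)`.
  have hexp : ∀ ε : ℂ, ε ^ 2 = 1 → NormedSpace.exp (pauliDiag (Fin.cons 0 m) + hamiltonian H)
      (pauli (k + 1).succ + (ε * Complex.I) • pauli (k + 2).succ) =
      (l (k + 1) : ℂ) • (pauli (k + 1).succ + (ε * Complex.I) • pauli (k + 2).succ) := by
    intro ε hε
    have hv : (pauliDiag (Fin.cons 0 m) + hamiltonian H)
        (pauli (k + 1).succ + (ε * Complex.I) • pauli (k + 2).succ) =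
        ((m (k + 1) : ℂ) - ε * (Real.pi * Complex.I)) •
          (pauli (k + 1).succ + (ε * Complex.I) • pauli (k + 2).succ) := by
      rw [add_apply, map_add, map_add, map_smul, map_smul, hdiag, hdiag, hmeq, h1, h2]
      match_scalars
      · ring
      · linear_combination (Real.pi : ℂ) * Complex.I ^ 2 * hε + (Real.pi : ℂ) * hI
    rw [exp_apply_of_apply_eq_smul hv]
    congr 1
    have hπ : Complex.exp (ε * (Real.pi * Complex.I)) = -1 := by
      have h3 : (ε - 1) * (ε + 1) = 0 := by linear_combination hε
      obtain rfl | rfl : ε = 1 ∨ ε = -1 :=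
        (mul_eq_zero.1 h3).imp sub_eq_zero.1 eq_neg_of_add_eq_zero_left
      · rw [one_mul, Complex.exp_pi_mul_I]
      · rw [neg_one_mul, Complex.exp_neg, Complex.exp_pi_mul_I]; norm_num
    rw [Complex.exp_sub, hπ, ← Complex.ofReal_exp, Real.exp_log_of_neg hneg]
    simp
  have hp := hexp 1 (by norm_num)
  have hn := hexp (-1) (by norm_num)
  refine superOp_ext_pauli' ?_ fun i => ?_
  · rw [exp_apply_of_apply_eq_smul hz]
    have := pauliDiag_pauli (Fin.cons 1 l) 0
    rw [Fin.cons_zero] at this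
    rw [Complex.exp_zero, one_smul]
    exact (this.trans (by rw [Complex.ofReal_one, one_smul]; rfl)).symm
  · rw [pauliDiag_pauli, Fin.cons_succ]
    obtain rfl | rfl | rfl : i = k ∨ i = k + 1 ∨ i = k + 2 := by
      fin_cases k <;> fin_cases i <;> decide
    · rw [exp_apply_of_apply_eq_smul hkk, ← Complex.ofReal_exp, Real.exp_log hk]
    · have := congrArg₂ (fun A B => (1 / 2 : ℂ) • (A + B)) hp hn
      simp only [map_add, map_smul] at this
      convert this using 1
      · module
      · module
    · have := congrArg₂ (fun A B => (-Complex.I / 2 : ℂ) • (A - B)) hp hn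
      simp only [map_add, map_smul] at this
      rw [← heq]
      convert this using 1
      · match_scalars <;> first | ring1 | linear_combination hI
      · match_scalars
        · linear_combination (l (k + 1) : ℂ) * hI
        · ring

end Generators

/-! ### Nonsingular and singular infinitely divisible cases -/

section Classification

variable {l : Fin 3 → ℝ}

theorem IsInfinitelyDivisible.mem_lindbladChannels (hE : IsInfinitelyDivisible (unitalDiag l))
    (hle : ∀ i, |l i| ≤ 1) (hne : ∀ i, l i ≠ 0) : unitalDiag l ∈ lindbladChannels 2 := by
  have hle' : ∀ i, l i ≤ 1 := fun i => (abs_le.1 (hle i)).2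
  by_cases hpos : ∀ k, 0 < l k
  · refine unitalDiag_mem_lindbladChannels hpos fun k => ?_
    -- The root argument needs an isolated eigenvalue; if `l k` is repeated, the inequality follows
    -- from `l i ≤ 1`.
    by_cases h1 : l k = l (k + 1)
    · rw [← h1]
      exact mul_le_of_le_one_right (hpos k).le (hle' _)
    by_cases h2 : l k = l (k + 2)
    · rw [← h2]
      exact mul_le_of_le_one_left (hpos k).le (hle' _)
    exact (hE.mul_le_of_ne h1 h2).2
  · obtain ⟨k, hk, hk1, hk2⟩ : ∃ k, 0 < l k ∧ l (k + 1) < 0 ∧ l (k + 2) < 0 := by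
      have hdet := hE.mul_nonneg
      rcases (hne 0).lt_or_gt with h0 | h0 <;> rcases (hne 1).lt_or_gt with h1 | h1 <;>
        rcases (hne 2).lt_or_gt with h2 | h2
      · exact absurd hdet (not_le.2 (mul_neg_of_pos_of_neg (mul_pos_of_neg_of_neg h0 h1) h2))
      · exact ⟨2, h2, h0, h1⟩
      · exact ⟨1, h1, h2, h0⟩
      · exact absurd hdet (not_le.2 (mul_neg_of_neg_of_pos (mul_neg_of_neg_of_pos h0 h1) h2))
      · exact ⟨0, h0, h1, h2⟩
      · exact absurd hdet (not_le.2 (mul_neg_of_neg_of_pos (mul_neg_of_pos_of_neg h0 h1) h2))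
      · exact absurd hdet (not_le.2 (mul_neg_of_pos_of_neg (mul_pos h0 h1) h2))
      · exact absurd (fun k => by fin_cases k <;> assumption) hpos
    -- Otherwise `l (k + 1)` is isolated, and `l (k + 2) * l k` would have to be nonnegative.
    have heq : l (k + 1) = l (k + 2) := by
      by_contra h
      have a1 : k + 1 + 1 = k + 2 := by fin_cases k <;> rfl
      have a2 : k + 1 + 2 = k := by fin_cases k <;> rfl
      have h1 := (hE.mul_le_of_ne (k := k + 1) (by rwa [a1]) (by rw [a2]; linarith)).1
      rw [a1, a2] at h1
      exact absurd h1 (not_le.2 (mul_neg_of_neg_of_pos hk2 hk))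
    exact unitalDiag_mem_lindbladChannels_of_neg hk (hle' k) heq hk1
      (hE.mul_le_of_ne (by linarith) (by linarith)).2

/-- A zero eigenvalue isolated from two nonzero ones would force their product to be both
nonnegative and at most zero. A single nonzero eigenvalue is isolated, so it dominates the zero
product. -/
theorem IsInfinitelyDivisible.eq_of_apply_eq_zero (hE : IsInfinitelyDivisible (unitalDiag l))
    (hle : ∀ i, |l i| ≤ 1) {k : Fin 3} (hk : l k = 0) :
    unitalDiag l = pauliDiag ![1, 0, 0, 0] ∨
      ∃ (a : Fin 3) (r : ℝ), 0 < r ∧ r ≤ 1 ∧ unitalDiag l = axisDiag a r 0 := by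
  have key : ∀ a : Fin 3, l (a + 1) = 0 → l (a + 2) = 0 → l a ≠ 0 →
      ∃ (a : Fin 3) (r : ℝ), 0 < r ∧ r ≤ 1 ∧ unitalDiag l = axisDiag a r 0 := by
    intro a h1 h2 h0
    have h3 := (hE.mul_le_of_ne (k := a) (by rwa [h1]) (by rwa [h2])).2
    rw [h1, zero_mul] at h3
    refine ⟨a, l a, h3.lt_of_ne h0.symm, (abs_le.1 (hle a)).2, ?_⟩
    refine congrArg unitalDiag (funext fun i => ?_)
    obtain rfl | rfl | rfl : i = a ∨ i = a + 1 ∨ i = a + 2 := by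
      fin_cases a <;> fin_cases i <;> decide
    · rw [Function.update_self]
    · rw [Function.update_of_ne (by fin_cases a <;> decide), h1]
    · rw [Function.update_of_ne (by fin_cases a <;> decide), h2]
  have a1 : k + 1 + 1 = k + 2 := by fin_cases k <;> rfl
  have a2 : k + 1 + 2 = k := by fin_cases k <;> rfl
  have a3 : k + 2 + 1 = k := by fin_cases k <;> rfl
  have a4 : k + 2 + 2 = k + 1 := by fin_cases k <;> rfl
  by_cases h1 : l (k + 1) = 0 <;> by_cases h2 : l (k + 2) = 0
  · left
    refine congrArg pauliDiag (funext fun i => ?_)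
    have hl : ∀ i, l i = 0 := by
      intro i
      obtain rfl | rfl | rfl : i = k ∨ i = k + 1 ∨ i = k + 2 := by
        fin_cases k <;> fin_cases i <;> decide
      exacts [hk, h1, h2]
    refine Fin.cases rfl (fun i => ?_) i
    rw [Fin.cons_succ, hl]
    fin_cases i <;> rfl
  · exact Or.inr (key (k + 2) (by rw [a3, hk]) (by rw [a4, h1]) h2)
  · exact Or.inr (key (k + 1) (by rw [a1, h2]) (by rw [a2, hk]) h1)
  · obtain ⟨h3, h4⟩ := hE.mul_le_of_ne (k := k) (by rw [hk]; exact Ne.symm h1)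
      (by rw [hk]; exact Ne.symm h2)
    rw [hk] at h4
    exact absurd (le_antisymm h4 h3) (mul_ne_zero h1 h2)

theorem not_isUnit_pauliDiag {v : Fin 4 → ℝ} {i : Fin 4} (hi : v i = 0) :
    ¬ IsUnit (pauliDiag v) := by
  rintro ⟨u, hu⟩
  have h1 : (↑u⁻¹ : SuperOp 2) (pauliDiag v (pauli i)) = pauli i := by
    rw [← hu, ← mul_apply_eq_comp, Units.inv_mul, one_apply_eq_self]
  rw [pauliDiag_pauli, hi, Complex.ofReal_zero, zero_smul, map_zero] at h1
  have h2 := pauli_mul_self i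
  rw [← h1, zero_mul] at h2
  exact zero_ne_one h2

end Classification

/-! ### Approximating the singular channels -/

section Sequences

theorem continuous_pauliDiag : Continuous pauliDiag := by
  have h : pauliDiag = fun v => ∑ i, (v i : ℂ) • pauliDiag (Pi.single i 1) := by
    funext v
    refine superOp_ext_pauli fun j => ?_
    rw [sum_apply, pauliDiag_pauli, Finset.sum_eq_single j]
    · rw [smul_apply, pauliDiag_pauli, Pi.single_eq_same, Complex.ofReal_one, one_smul]
    · intro i _ hij
      rw [smul_apply, pauliDiag_pauli, Pi.single_eq_of_ne hij.symm, Complex.ofReal_zero, zero_smul,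
        smul_zero]
    · simp
  rw [h]
  refine continuous_finsetSum _ fun i _ => ?_
  exact (Complex.continuous_ofReal.comp (continuous_apply i)).smul continuous_const

theorem vec_zero_eq_cons (c : ℝ) : ![0, c, c, c] = (Fin.cons 0 fun _ => c : Fin 4 → ℝ) := by
  funext i
  fin_cases i <;> rfl

theorem hasLindbladForm_depolarizing (n : ℕ) :
    HasLindbladForm (pauliDiag ![0, -(n : ℝ), -(n : ℝ), -(n : ℝ)]) := by
  rw [vec_zero_eq_cons]
  refine hasLindbladForm_pauliDiag fun k => ?_
  have : (0 : ℝ) ≤ n := n.cast_nonneg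
  linarith

theorem tendsto_exp_depolarizing :
    Tendsto (fun n : ℕ => NormedSpace.exp (pauliDiag ![0, -(n : ℝ), -(n : ℝ), -(n : ℝ)])) atTop
      (𝓝 (pauliDiag ![1, 0, 0, 0])) := by
  simp only [exp_pauliDiag]
  refine (continuous_pauliDiag.tendsto _).comp (tendsto_pi_nhds.2 fun i => ?_)
  have h : Tendsto (fun n : ℕ => Real.exp (-(n : ℝ))) atTop (𝓝 0) :=
    Real.tendsto_exp_neg_atTop_nhds_zero.comp tendsto_natCast_atTop_atTop
  fin_cases i
  · simp
  all_goals exact h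

theorem axisDiag_mem_lindbladChannels (a : Fin 3) {l e : ℝ} (hl : 0 < l) (hl1 : l ≤ 1)
    (he : 0 < e) (hel : e * e ≤ l) : axisDiag a l e ∈ lindbladChannels 2 := by
  have h1 : l * e ≤ e := mul_le_of_le_one_left he.le hl1
  have h2 : e * l ≤ e := mul_le_of_le_one_right he.le hl1
  refine unitalDiag_mem_lindbladChannels (fun k => ?_) fun k => ?_
  · by_cases h : k = a
    · rw [h, Function.update_self]; exact hl
    · rw [Function.update_of_ne h]; exact he
  · fin_cases a <;> fin_cases k <;> simp [Function.update] <;> assumption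

theorem axisDiag_sqrt_mem_lindbladChannels (a : Fin 3) {l : ℝ} (hl : 0 < l) (hl1 : l ≤ 1) {n : ℕ}
    (hn : 1 ≤ n) : axisDiag a l (Real.sqrt l / n) ∈ lindbladChannels 2 := by
  have hn' : (1 : ℝ) ≤ n := by exact_mod_cast hn
  have hs := Real.sqrt_pos.2 hl
  refine axisDiag_mem_lindbladChannels a hl hl1 (by positivity) ?_
  rw [div_mul_div_comm, Real.mul_self_sqrt hl.le]
  exact div_le_self hl.le (by nlinarith)

theorem tendsto_axisDiag (a : Fin 3) (l : ℝ) :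
    Tendsto (fun n : ℕ => axisDiag a l (Real.sqrt l / n)) atTop (𝓝 (axisDiag a l 0)) := by
  refine (continuous_pauliDiag.tendsto _).comp (tendsto_pi_nhds.2 fun i => ?_)
  refine Fin.cases ?_ (fun i => ?_) i
  · simp
  · simp only [Fin.cons_succ]
    by_cases h : i = a
    · subst h; simp
    · simp only [Function.update_of_ne h]
      exact tendsto_const_div_atTop_nhds_zero_nat _

theorem depolarizing_mem_closure_lindbladChannels :
    pauliDiag ![1, 0, 0, 0] ∈ closure (lindbladChannels 2) :=
  mem_closure_of_tendsto tendsto_exp_depolarizing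
    (Eventually.of_forall fun n => (hasLindbladForm_depolarizing n).exp_mem_lindbladChannels)

theorem axisDiag_mem_closure_lindbladChannels (a : Fin 3) {l : ℝ} (hl : 0 < l) (hl1 : l ≤ 1) :
    axisDiag a l 0 ∈ closure (lindbladChannels 2) := by
  refine mem_closure_of_tendsto (tendsto_axisDiag a l) ?_
  filter_upwards [eventually_ge_atTop 1] with n hn
  exact axisDiag_sqrt_mem_lindbladChannels a hl hl1 hn

theorem isPauliChannel_depolarizing : IsPauliChannel (pauliDiag ![1, 0, 0, 0]) := by
  have : (![1, 0, 0, 0] : Fin 4 → ℝ) = Fin.cons 1 0 := by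
    funext i; fin_cases i <;> rfl
  rw [this]
  exact isPauliChannel_unitalDiag (by simp) (by simp) (by simp) (by simp)

theorem isPauliChannel_axisDiag (a : Fin 3) {l : ℝ} (hl : 0 < l) (hl1 : l ≤ 1) :
    IsPauliChannel (axisDiag a l 0) := by
  refine isPauliChannel_unitalDiag ?_ ?_ ?_ ?_ <;> fin_cases a <;> simp [Function.update] <;>
    linarith

theorem IsPauliChannel.isInfinitelyDivisible {E : SuperOp 2} (hE : IsPauliChannel E)
    (h : E ∈ closure (lindbladChannels 2)) : IsInfinitelyDivisible E :=
  IsLDivisible.isInfinitelyDivisible ⟨hE.isChannel, h⟩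

end Sequences

/-- Infinitely divisible Pauli channels are either singular, and then in an explicit list, or have
a logarithm of Lindblad form. -/
theorem IsPauliChannel.singular_or_mem_lindbladChannels {E : SuperOp 2} (hE : IsPauliChannel E)
    (hdiv : IsInfinitelyDivisible E) :
    (E = pauliDiag ![1, 0, 0, 0] ∨
      ∃ (a : Fin 3) (l : ℝ), 0 < l ∧ l ≤ 1 ∧ E = axisDiag a l 0) ∨ E ∈ lindbladChannels 2 := by
  obtain ⟨l, rfl, hle⟩ := hE.exists_eq_unitalDiag
  by_cases h : ∃ k, l k = 0
  · obtain ⟨k, hk⟩ := h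
    exact Or.inl (hdiv.eq_of_apply_eq_zero hle hk)
  · push Not at h
    exact Or.inr (hdiv.mem_lindbladChannels hle h)

theorem IsPauliChannel.isLDivisible_iff_isInfinitelyDivisible {E : SuperOp 2}
    (hE : IsPauliChannel E) : IsLDivisible E ↔ IsInfinitelyDivisible E := by
  refine ⟨fun h => h.isInfinitelyDivisible, fun h => ⟨hE.isChannel, ?_⟩⟩
  rcases hE.singular_or_mem_lindbladChannels h with (rfl | ⟨a, l, hl, hl1, rfl⟩) | hmem
  · exact depolarizing_mem_closure_lindbladChannels
  · exact axisDiag_mem_closure_lindbladChannels a hl hl1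
  · exact subset_closure hmem

theorem isPauliChannel_and_isInfinitelyDivisible_and_not_isUnit_iff (E : SuperOp 2) :
    (IsPauliChannel E ∧ IsInfinitelyDivisible E ∧ ¬ IsUnit E) ↔
      (E = pauliDiag ![1, 0, 0, 0] ∨
        ∃ (a : Fin 3) (l : ℝ), 0 < l ∧ l ≤ 1 ∧ E = axisDiag a l 0) := by
  constructor
  · rintro ⟨hE, hdiv, hu⟩
    exact (hE.singular_or_mem_lindbladChannels hdiv).resolve_right fun h => hu h.2.1
  · rintro (rfl | ⟨a, l, hl, hl1, rfl⟩)
    · exact ⟨isPauliChannel_depolarizing, isPauliChannel_depolarizing.isInfinitelyDivisible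
        depolarizing_mem_closure_lindbladChannels, not_isUnit_pauliDiag (i := 1) rfl⟩
    · have hP := isPauliChannel_axisDiag a hl hl1
      refine ⟨hP, hP.isInfinitelyDivisible (axisDiag_mem_closure_lindbladChannels a hl hl1),
        not_isUnit_pauliDiag (i := (a + 1).succ) ?_⟩
      rw [Fin.cons_succ, Function.update_of_ne (by fin_cases a <;> decide)]

end QuantumChannel

end

theorem mainTheorem2 :
    -- the L-divisible Pauli channels are exactly the infinitely divisible Pauli channels
    ({E : QuantumChannel.SuperOp 2 |
        QuantumChannel.IsPauliChannel E ∧ QuantumChannel.IsLDivisible E} =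
      {E : QuantumChannel.SuperOp 2 |
        QuantumChannel.IsPauliChannel E ∧ QuantumChannel.IsInfinitelyDivisible E}) ∧
    -- the singular ones
    (∀ E : QuantumChannel.SuperOp 2,
      (QuantumChannel.IsPauliChannel E ∧ QuantumChannel.IsInfinitelyDivisible E ∧ ¬ IsUnit E) ↔
        (E = QuantumChannel.pauliDiag ![1, 0, 0, 0] ∨
          ∃ (a : Fin 3) (l : ℝ), 0 < l ∧ l ≤ 1 ∧ E = QuantumChannel.axisDiag a l 0)) ∧
    -- explicit sequence for the completely depolarizing channel
    ((∀ n : ℕ,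
        QuantumChannel.HasLindbladForm
          (QuantumChannel.pauliDiag ![0, -(n : ℝ), -(n : ℝ), -(n : ℝ)]) ∧
        NormedSpace.exp (QuantumChannel.pauliDiag ![0, -(n : ℝ), -(n : ℝ), -(n : ℝ)]) ∈
          QuantumChannel.lindbladChannels 2) ∧
      Filter.Tendsto
        (fun n : ℕ =>
          NormedSpace.exp (QuantumChannel.pauliDiag ![0, -(n : ℝ), -(n : ℝ), -(n : ℝ)]))
        Filter.atTop (nhds (QuantumChannel.pauliDiag ![1, 0, 0, 0]))) ∧
    -- explicit sequences for the remaining singular channels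
    (∀ (a : Fin 3) (l : ℝ), 0 < l → l ≤ 1 →
      (∀ n : ℕ, 1 ≤ n →
        QuantumChannel.axisDiag a l (Real.sqrt l / n) ∈ QuantumChannel.lindbladChannels 2) ∧
      Filter.Tendsto (fun n : ℕ => QuantumChannel.axisDiag a l (Real.sqrt l / n))
        Filter.atTop (nhds (QuantumChannel.axisDiag a l 0))) := by
  refine ⟨Set.ext fun E => and_congr_right fun hE => ?_, fun E => ?_, ⟨fun n => ⟨?_, ?_⟩, ?_⟩,
    fun a l hl hl1 => ⟨fun n hn => ?_, ?_⟩⟩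
  · exact hE.isLDivisible_iff_isInfinitelyDivisible
  · exact QuantumChannel.isPauliChannel_and_isInfinitelyDivisible_and_not_isUnit_iff E
  · exact QuantumChannel.hasLindbladForm_depolarizing n
  · exact (QuantumChannel.hasLindbladForm_depolarizing n).exp_mem_lindbladChannels
  · exact QuantumChannel.tendsto_exp_depolarizing
  · exact QuantumChannel.axisDiag_sqrt_mem_lindbladChannels a hl hl1 hn
  · exact QuantumChannel.tendsto_axisDiag a l
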